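/- Let $\mathcal A$ be a unital $C^*$-algebra, let $\Gamma$ be a totally ordered abelian group and $\Gamma^+=\{x\in\Gamma: x\ge 0\}$. An *action* of $\Gamma^+$ on $\mathcal A$ is a family $\mathcal V=\{\mathcal V_x\}_{x\in\Gamma^+}$ of bounded positive linear maps on $\mathcal A$ with $\mathcal V_0=\mathrm{id}$ and $\mathcal V_x\circ\mathcal V_y=\mathcal V_{x+y}$. It is *finely representable* if there are a unital $C^*$-algebra $C$, an injective unital $*$-homomorphism $\sigma:\mathcal A\to C$ and partial isometries $U_x\in C$ ($x\in\Gamma^+$) with $U_{x+y}=U_xU_y$, $\sigma(\mathcal V_x(a))=U_x\sigma(a)U_x^*$ and $U_x^*\sigma(a)U_x\in\sigma(\mathcal A)$ for all $x,y\in\Gamma^+$, $a\in\mathcal A$. A pair $(\mathcal V,\mathcal H)$ of actions of $\Gamma^+$ on $\mathcal A$ is a *complete interaction* if for all $x,y\in\Gamma^+$ and $a,b\in\mathcal A$: $\mathcal V_x\mathcal H_x\mathcal V_x=\mathcal V_x$; $\mathcal H_x\mathcal V_x\mathcal H_x=\mathcal H_x$; $\mathcal V_x(ab)=\mathcal V_x(a)\mathcal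 V_x(b)$ if $a$ or $b$ lies in $\mathcal H_x(\mathcal A)$; $\mathcal H_x(ab)=\mathcal H_x(a)\mathcal H_x(b)$ if $a$ or $b$ lies in $\mathcal V_x(\mathcal A)$; $\mathcal H_x(\mathcal V_x(a))=\mathcal H_x(1)a\mathcal H_x(1)$; $\mathcal V_x(\mathcal H_x(a))=\mathcal V_x(1)a\mathcal V_x(1)$; and $\mathcal H_y(1)\mathcal V_x(1)=\mathcal V_x(1)\mathcal H_y(1)$. Let $\mathcal V$ be a finely representable action and $(\mathcal V,\mathcal H)$ the corresponding complete interaction. The crossed product $\mathcal A\rtimes_{(\mathcal V,\mathcal H)}\Gamma$ is the universal unital $C^*$-algebra generated by a copy of $\mathcal A$ and partial isometries $\hat U_x$, $x\in\Gamma^+$, subject to the relations $\mathcal V_x(a)=\hat U_xa\hat U_x^*$, $\mathcal H_x(a)=\hat U_x^*a\hat U_x$ and $\hat U_x\hat U_y=\hat U_{x+y}$ ($a\in\mathcal A$, $x,y\in\Gamma^+$). Let $C_0$ be its dense $*$-subalgebra generated by $\mathcal A$ and $\{\hat U_x\}_{x\in\Gamma^+}$. A *quasi-monomial of degree $x$ of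 positive* (respectively *negative*) *type* is a finite sum of products $a_1\hat U_{x_1}\cdots a_n\hat U_{x_n}$ (respectively $a_1\hat U_{x_1}^*\cdots a_n\hat U_{x_n}^*$) with $n\ge1$, $a_i\in\mathcal A$, $x_i\in\Gamma^+$ and $x_1+\dots+x_n=x$. There is a unique bounded linear map $E_0:\mathcal A\rtimes_{(\mathcal V,\mathcal H)}\Gamma\to\mathcal A$ such that $$E_0\Big(\sum_{x\in F}q_{-x}+a_0+\sum_{x\in F}q_x\Big)=a_0$$ whenever $F\subset\Gamma^+\setminus\{0\}$ is finite, $a_0\in\mathcal A$, and $q_{x}$, $q_{-x}$ are quasi-monomials of degree $x$ of positive and negative type, respectively ($x\in F$). This $E_0$ is a conditional expectation onto $\mathcal A$: it is positive and contractive, it is the identity on $\mathcal A$, and $E_0(acb)=aE_0(c)b$ for $a,b\in\mathcal A$ and all $c$ in the crossed product. Moreover, for every $a\in C_0$, $$\|a\|=\lim_{k\to\infty}\big\|E_0\big[(aa^*)^{2k}\big]\big\|^{1/(4k)}.$$ -/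

import Mathlib

universe u v w

noncomputable section

namespace Interaction

/-! ### C⋆-seminorms and their completions -/

/-- A C⋆-seminorm on a complex unital `*`-algebra. -/
structure CStarSeminorm (P : Type u) [Ring P] [Algebra ℂ P] [StarRing P]
    extends Seminorm ℂ P where
  mul_le' : ∀ x y, toFun (x * y) ≤ toFun x * toFun y
  star_mul_self' : ∀ x, toFun (star x * x) = toFun x * toFun x

section Completion

variable {P : Type u} [Ring P] [Algebra ℂ P] [StarRing P]

namespace CStarSeminorm

theorem map_star (q : CStarSeminorm P) (x : P) :
    q.toSeminorm (star x) = q.toSeminorm x := by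
  have key : ∀ y : P, q.toSeminorm y ≤ q.toSeminorm (star y) := by
    intro y
    have h1 : q.toSeminorm (star y * y) = q.toSeminorm y * q.toSeminorm y :=
      q.star_mul_self' y
    have h2 : q.toSeminorm (star y * y) ≤ q.toSeminorm (star y) * q.toSeminorm y :=
      q.mul_le' _ _
    rcases (apply_nonneg q.toSeminorm y).eq_or_lt with h | h
    · rw [← h]; exact apply_nonneg _ _
    · exact le_of_mul_le_mul_right (h1 ▸ h2) h
  refine le_antisymm ?_ (key x)
  simpa using key (star x)

/-- The algebra `P`, to be equipped with the seminorm `q`. -/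
def Pre (_q : CStarSeminorm P) : Type u := P

instance (q : CStarSeminorm P) : SeminormedRing q.Pre :=
  { AddGroupSeminorm.toSeminormedAddCommGroup (E := P) q.toSeminorm.toAddGroupSeminorm,
    (inferInstanceAs (Ring P) : Ring q.Pre) with
    norm_mul_le := q.mul_le' }

instance (q : CStarSeminorm P) : Algebra ℂ q.Pre := inferInstanceAs (Algebra ℂ P)

instance (q : CStarSeminorm P) : StarRing q.Pre := inferInstanceAs (StarRing P)

theorem norm_pre (q : CStarSeminorm P) (x : q.Pre) : ‖x‖ = q.toSeminorm (x : P) := rfl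

instance (q : CStarSeminorm P) : NormedSpace ℂ q.Pre where
  toModule := Algebra.toModule
  norm_smul_le c x := (map_smul_eq_mul q.toSeminorm c (x : P)).le

/-- The C⋆-algebra obtained from `P` by separation and completion with respect to `q`. -/
def Compl (q : CStarSeminorm P) : Type u := UniformSpace.Completion q.Pre

instance (q : CStarSeminorm P) : NormedRing q.Compl :=
  inferInstanceAs (NormedRing (UniformSpace.Completion q.Pre))

instance (q : CStarSeminorm P) : CompleteSpace q.Compl :=
  inferInstanceAs (CompleteSpace (UniformSpace.Completion q.Pre))

instance (q : CStarSeminorm P) : Algebra ℂ q.Compl :=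
  inferInstanceAs (Algebra ℂ (UniformSpace.Completion q.Pre))

/-- The canonical map from `P` to the completion. -/
def toCompl (q : CStarSeminorm P) : P →ₐ[ℂ] q.Compl :=
  { (UniformSpace.Completion.coeRingHom : q.Pre →+* UniformSpace.Completion q.Pre) with
    commutes' := fun _ => rfl }

theorem norm_toCompl (q : CStarSeminorm P) (x : P) : ‖q.toCompl x‖ = q.toSeminorm x :=
  UniformSpace.Completion.norm_coe (E := q.Pre) x

theorem denseRange_toCompl (q : CStarSeminorm P) : DenseRange q.toCompl :=
  UniformSpace.Completion.denseRange_coe (α := q.Pre)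

@[elab_as_elim]
theorem induction_on (q : CStarSeminorm P) {p : q.Compl → Prop} (x : q.Compl)
    (hc : IsClosed {x | p x}) (h : ∀ x : P, p (q.toCompl x)) : p x :=
  q.denseRange_toCompl.induction_on x hc h

instance (q : CStarSeminorm P) : NormedAlgebra ℂ q.Compl :=
  { (inferInstance : Algebra ℂ q.Compl) with
    norm_smul_le := fun c x => by
      refine q.induction_on x ?_ ?_
      · refine isClosed_le ?_ ?_
        · simp only [Algebra.smul_def]; fun_prop
        · fun_prop
      · intro x
        rw [← map_smul, norm_toCompl, norm_toCompl, map_smul_eq_mul] }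

theorem isometry_star_pre (q : CStarSeminorm P) : Isometry (star : q.Pre → q.Pre) :=
  AddMonoidHomClass.isometry_of_norm (starAddEquiv : q.Pre ≃+ q.Pre) q.map_star

instance (q : CStarSeminorm P) : Star q.Compl :=
  ⟨UniformSpace.Completion.map (star : q.Pre → q.Pre)⟩

theorem toCompl_star (q : CStarSeminorm P) (x : P) :
    q.toCompl (star x) = star (q.toCompl x) :=
  (UniformSpace.Completion.map_coe q.isometry_star_pre.uniformContinuous x).symm

theorem continuous_star_compl (q : CStarSeminorm P) :
    Continuous (star : q.Compl → q.Compl) :=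
  UniformSpace.Completion.continuous_map

instance (q : CStarSeminorm P) : StarRing q.Compl where
  star_involutive x := by
    have hs := q.continuous_star_compl
    refine q.induction_on x (isClosed_eq (hs.comp hs) continuous_id) fun x => ?_
    rw [← toCompl_star, ← toCompl_star, star_star]
  star_mul x y := by
    have hs := q.continuous_star_compl
    refine q.induction_on x (isClosed_eq (by fun_prop) (by fun_prop)) fun x => ?_
    refine q.induction_on y (isClosed_eq (by fun_prop) (by fun_prop)) fun y => ?_
    rw [← map_mul, ← toCompl_star, ← toCompl_star, ← toCompl_star, star_mul, map_mul]
  star_add x y := by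
    have hs := q.continuous_star_compl
    refine q.induction_on x (isClosed_eq (by fun_prop) (by fun_prop)) fun x => ?_
    refine q.induction_on y (isClosed_eq (by fun_prop) (by fun_prop)) fun y => ?_
    rw [← map_add, ← toCompl_star, ← toCompl_star, ← toCompl_star, star_add, map_add]

instance (q : CStarSeminorm P) : CStarRing q.Compl where
  norm_mul_self_le x := by
    have hs := q.continuous_star_compl
    refine q.induction_on x (isClosed_le (by fun_prop) (by fun_prop)) fun x => ?_
    rw [← toCompl_star, ← map_mul, norm_toCompl, norm_toCompl]
    exact (q.star_mul_self' x).ge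

instance [StarModule ℂ P] (q : CStarSeminorm P) : StarModule ℂ q.Compl where
  star_smul c x := by
    have hs := q.continuous_star_compl
    refine q.induction_on x (isClosed_eq (hs.comp (continuous_const_smul c))
      (hs.const_smul (star c))) fun x => ?_
    rw [← map_smul, ← toCompl_star, ← toCompl_star, star_smul, map_smul]

instance [StarModule ℂ P] (q : CStarSeminorm P) : CStarAlgebra q.Compl where

end CStarSeminorm

end Completion

/-! ### Actions and interactions -/

/-- The positive cone `Γ⁺` of an ordered abelian group. -/
abbrev PosCone (Γ : Type v) [AddCommGroup Γ] [LinearOrder Γ] [IsOrderedAddMonoid Γ] : Type v :=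
  {x : Γ // 0 ≤ x}

section Actions

variable (A : Type u) [CStarAlgebra A]
variable (Γ : Type v) [AddCommGroup Γ] [LinearOrder Γ] [IsOrderedAddMonoid Γ]

/-- An action of `Γ⁺` on `A` by bounded positive linear maps.  (An element of a C⋆-algebra is
positive if and only if it is of the form `b⋆ b`.) -/
structure PositiveAction where
  toFun : PosCone Γ → (A →L[ℂ] A)
  positive' : ∀ x a, ∃ b, toFun x (star a * a) = star b * b
  zero' : ∀ a, toFun 0 a = a
  comp' : ∀ x y a, toFun x (toFun y a) = toFun (x + y) a

variable {A Γ}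

instance : CoeFun (PositiveAction A Γ) (fun _ => PosCone Γ → (A →L[ℂ] A)) :=
  ⟨PositiveAction.toFun⟩

/-- The pair `(V, H)` of actions is an interaction. -/
structure IsInteraction (V H : PositiveAction A Γ) : Prop where
  vhv : ∀ x a, V x (H x (V x a)) = V x a
  hvh : ∀ x a, H x (V x (H x a)) = H x a
  v_mul : ∀ x a b, (a ∈ Set.range (H x) ∨ b ∈ Set.range (H x)) →
    V x (a * b) = V x a * V x b
  h_mul : ∀ x a b, (a ∈ Set.range (V x) ∨ b ∈ Set.range (V x)) →
    H x (a * b) = H x a * H x b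

/-- The pair `(V, H)` of actions is a complete interaction. -/
structure IsCompleteInteraction (V H : PositiveAction A Γ) : Prop extends IsInteraction V H where
  h_v : ∀ x a, H x (V x a) = H x 1 * a * H x 1
  v_h : ∀ x a, V x (H x a) = V x 1 * a * V x 1
  comm : ∀ x y, H y 1 * V x 1 = V x 1 * H y 1

/-- `(C, σ, U)` is a covariant representation of the action `V`. -/
structure IsCovariantRep (V : PositiveAction A Γ) {C : Type w} [CStarAlgebra C]
    (σ : A →⋆ₐ[ℂ] C) (U : PosCone Γ → C) : Prop where
  injective : Function.Injective σ
  map_add : ∀ x y, U (x + y) = U x * U y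
  partial_isometry : ∀ x, U x * star (U x) * U x = U x
  cov : ∀ x a, σ (V x a) = U x * σ a * star (U x)
  mem_range : ∀ x a, star (U x) * σ a * U x ∈ Set.range σ

/-- An action is finely representable if it has a covariant representation. -/
def FinelyRepresentable (V : PositiveAction A Γ) : Prop :=
  ∃ (C : Type w) (_ : CStarAlgebra C) (σ : A →⋆ₐ[ℂ] C) (U : PosCone Γ → C),
    IsCovariantRep V σ U

/-- `(C, σ, U)` satisfies the defining relations of the crossed product by `(V, H)`; here
`σ` is not required to be injective. -/
structure SatisfiesRelations (V H : PositiveAction A Γ) {C : Type w} [CStarAlgebra C]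
    (σ : A →⋆ₐ[ℂ] C) (U : PosCone Γ → C) : Prop where
  partial_isometry : ∀ x, U x * star (U x) * U x = U x
  rel_v : ∀ x a, σ (V x a) = U x * σ a * star (U x)
  rel_h : ∀ x a, σ (H x a) = star (U x) * σ a * U x
  mul : ∀ x y, U x * U y = U (x + y)

end Actions

/-! ### The free `*`-algebra on the generators -/

/-- The generators of the crossed product and their formal adjoints; the adjoint of `el a` is
`el (star a)`. -/
inductive Gen (A : Type u) (Λ : Type v) : Type (max u v)
  | el (a : A) : Gen A Λ
  | iso (x : Λ) : Gen A Λ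
  | isoStar (x : Λ) : Gen A Λ

/-- The formal adjoint on generators. -/
def Gen.adj {A : Type u} [Star A] {Λ : Type v} : Gen A Λ → Gen A Λ
  | .el a => .el (star a)
  | .iso x => .isoStar x
  | .isoStar x => .iso x

theorem Gen.adj_adj {A : Type u} [InvolutiveStar A] {Λ : Type v} (g : Gen A Λ) :
    g.adj.adj = g := by
  cases g <;> simp [Gen.adj]

/-- The free complex unital algebra on the generators, with the conjugate-linear involution that
reverses products and extends the formal adjoint of generators. -/
def FreeStar (A : Type u) (Λ : Type v) : Type (max u v) := FreeAlgebra ℂ (Gen A Λ)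

namespace FreeStar

variable {A : Type u} {Λ : Type v}

instance : Ring (FreeStar A Λ) := inferInstanceAs (Ring (FreeAlgebra ℂ (Gen A Λ)))

instance : Algebra ℂ (FreeStar A Λ) := inferInstanceAs (Algebra ℂ (FreeAlgebra ℂ (Gen A Λ)))

/-- The generators, as elements of the free algebra. -/
def of (g : Gen A Λ) : FreeStar A Λ := FreeAlgebra.ι ℂ g

/-- The universal property of the free algebra. -/
def lift {B : Type w} [Ring B] [Algebra ℂ B] (f : Gen A Λ → B) : FreeStar A Λ →ₐ[ℂ] B :=
  FreeAlgebra.lift ℂ f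

theorem lift_of {B : Type w} [Ring B] [Algebra ℂ B] (f : Gen A Λ → B) (g : Gen A Λ) :
    lift f (of g) = f g := FreeAlgebra.lift_ι_apply f g

@[elab_as_elim]
theorem induction {p : FreeStar A Λ → Prop} (hs : ∀ c : ℂ, p (algebraMap ℂ _ c))
    (hg : ∀ g, p (of g)) (hm : ∀ a b, p a → p b → p (a * b))
    (ha : ∀ a b, p a → p b → p (a + b)) (x : FreeStar A Λ) : p x :=
  FreeAlgebra.induction ℂ (Gen A Λ) hs hg hm ha x

/-- The opposite algebra with conjugated scalar multiplication. -/
@[reducible]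
def conjOpAlgebra : Algebra ℂ (FreeStar A Λ)ᵐᵒᵖ :=
  RingHom.toAlgebra' ((algebraMap ℂ (FreeStar A Λ)ᵐᵒᵖ).comp (starRingEnd ℂ))
    fun c x => Algebra.commutes (starRingEnd ℂ c) x

variable [InvolutiveStar A]

/-- The involution, as a homomorphism to the opposite ring. -/
def adjHom : FreeStar A Λ →+* (FreeStar A Λ)ᵐᵒᵖ :=
  letI := conjOpAlgebra (A := A) (Λ := Λ)
  (FreeAlgebra.lift ℂ (fun g : Gen A Λ => MulOpposite.op (of g.adj))).toRingHom

theorem adjHom_of (g : Gen A Λ) : adjHom (of g) = MulOpposite.op (of g.adj) :=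
  letI := conjOpAlgebra (A := A) (Λ := Λ)
  FreeAlgebra.lift_ι_apply (fun g : Gen A Λ => MulOpposite.op (of g.adj)) g

theorem adjHom_algebraMap (c : ℂ) :
    adjHom (algebraMap ℂ (FreeStar A Λ) c) =
      MulOpposite.op (algebraMap ℂ (FreeStar A Λ) (starRingEnd ℂ c)) :=
  letI := conjOpAlgebra (A := A) (Λ := Λ)
  (FreeAlgebra.lift ℂ (fun g : Gen A Λ => MulOpposite.op (of g.adj))).commutes c

instance : StarRing (FreeStar A Λ) where
  star x := (adjHom x).unop
  star_involutive x := by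
    induction x using FreeStar.induction with
    | hs c => simp [adjHom_algebraMap]
    | hg g => simp [adjHom_of, Gen.adj_adj]
    | hm a b ha hb => simp only [map_mul, MulOpposite.unop_mul, ha, hb]
    | ha a b ha hb => simp only [map_add, MulOpposite.unop_add, ha, hb]
  star_mul x y := by simp
  star_add x y := by simp

theorem star_of (g : Gen A Λ) : star (of g) = of g.adj := by
  change (adjHom (of g)).unop = _
  rw [adjHom_of]; rfl

theorem star_algebraMap (c : ℂ) :
    star (algebraMap ℂ (FreeStar A Λ) c) = algebraMap ℂ (FreeStar A Λ) (star c) := by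
  change (adjHom (algebraMap ℂ (FreeStar A Λ) c)).unop = _
  rw [adjHom_algebraMap]; rfl

instance : StarModule ℂ (FreeStar A Λ) where
  star_smul c x := by
    rw [Algebra.smul_def, Algebra.smul_def, star_mul, star_algebraMap, Algebra.commutes]

end FreeStar

/-! ### The crossed product -/

section CrossedProduct

variable {A : Type u} [CStarAlgebra A]
variable {Γ : Type v} [AddCommGroup Γ] [LinearOrder Γ] [IsOrderedAddMonoid Γ]

open FreeStar Gen

/-- A C⋆-seminorm on the free `*`-algebra that vanishes on the defining relations of the crossed
product: the map `A → FreeStar A Γ⁺` becomes a unital `*`-homomorphism, the `U x` become partial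
isometries satisfying the covariance relations. -/
structure Admissible (V H : PositiveAction A Γ) (q : CStarSeminorm (FreeStar A (PosCone Γ))) :
    Prop where
  el_add : ∀ a b, q.toSeminorm (of (el (a + b)) - (of (el a) + of (el b))) = 0
  el_smul : ∀ (c : ℂ) a, q.toSeminorm (of (el (c • a)) - c • of (el a)) = 0
  el_mul : ∀ a b, q.toSeminorm (of (el (a * b)) - of (el a) * of (el b)) = 0
  el_one : q.toSeminorm (of (el 1) - 1) = 0
  partial_isometry : ∀ x, q.toSeminorm (of (iso x) * of (isoStar x) * of (iso x) - of (iso x)) = 0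
  rel_v : ∀ x a, q.toSeminorm (of (el (V x a)) - of (iso x) * of (el a) * of (isoStar x)) = 0
  rel_h : ∀ x a, q.toSeminorm (of (el (H x a)) - of (isoStar x) * of (el a) * of (iso x)) = 0
  mul : ∀ x y, q.toSeminorm (of (iso x) * of (iso y) - of (iso (x + y))) = 0

variable {V H : PositiveAction A Γ}

theorem toCompl_eq_of_sub {P : Type u} [Ring P] [Algebra ℂ P] [StarRing P] [StarModule ℂ P]
    (q : CStarSeminorm P) {x y : P} (h : q.toSeminorm (x - y) = 0) :
    q.toCompl x = q.toCompl y := by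
  rw [← sub_eq_zero, ← map_sub, ← norm_eq_zero, q.norm_toCompl, h]

namespace Admissible

variable {q : CStarSeminorm (FreeStar A (PosCone Γ))}

/-- The homomorphism from `A` to the completion with respect to an admissible seminorm. -/
def incl (hq : Admissible V H q) : A →⋆ₐ[ℂ] q.Compl where
  toFun a := q.toCompl (of (el a))
  map_one' := by rw [toCompl_eq_of_sub q hq.el_one, map_one]
  map_mul' a b := by rw [toCompl_eq_of_sub q (hq.el_mul a b), map_mul]
  map_zero' := by
    have h := toCompl_eq_of_sub q (hq.el_smul 0 0)
    simpa using h
  map_add' a b := by rw [toCompl_eq_of_sub q (hq.el_add a b), map_add]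
  commutes' c := by
    rw [Algebra.algebraMap_eq_smul_one, toCompl_eq_of_sub q (hq.el_smul c 1), map_smul,
      toCompl_eq_of_sub q hq.el_one, map_one, Algebra.algebraMap_eq_smul_one]
  map_star' a := by rw [← q.toCompl_star, star_of]; rfl

theorem satisfiesRelations (hq : Admissible V H q) :
    SatisfiesRelations V H hq.incl (fun x => q.toCompl (of (iso x))) := by
  have hs : ∀ x, q.toCompl (of (isoStar x)) = star (q.toCompl (of (iso x))) := fun x => by
    rw [← q.toCompl_star, star_of]; rfl
  constructor
  · intro x
    rw [← hs, ← map_mul, ← map_mul, toCompl_eq_of_sub q (hq.partial_isometry x)]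
  · intro x a
    change q.toCompl _ = _ * q.toCompl _ * _
    rw [← hs, ← map_mul, ← map_mul, toCompl_eq_of_sub q (hq.rel_v x a)]
  · intro x a
    change q.toCompl _ = _ * q.toCompl _ * _
    rw [← hs, ← map_mul, ← map_mul, toCompl_eq_of_sub q (hq.rel_h x a)]
  · intro x y
    rw [← map_mul, toCompl_eq_of_sub q (hq.mul x y)]

theorem el_le (hq : Admissible V H q) (a : A) : q.toSeminorm (of (el a)) ≤ ‖a‖ := by
  rw [← q.norm_toCompl]
  exact NonUnitalStarAlgHom.norm_apply_le hq.incl a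

theorem norm_iso_le (hq : Admissible V H q) (x : PosCone Γ) :
    q.toSeminorm (of (iso x)) ≤ 1 := by
  rw [← q.norm_toCompl]
  have h := hq.satisfiesRelations.partial_isometry x
  set u := q.toCompl (of (iso x))
  have h1 : ‖star u * u‖ = ‖u‖ * ‖u‖ := CStarRing.norm_star_mul_self
  have h2 : star u * u * (star u * u) = star u * u := by
    rw [mul_assoc, ← mul_assoc u, h]
  have h3 : ‖star (star u * u) * (star u * u)‖ = ‖star u * u‖ * ‖star u * u‖ :=
    CStarRing.norm_star_mul_self
  rw [star_mul, star_star, h2, h1] at h3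
  by_contra hlt
  push Not at hlt
  nlinarith [mul_lt_mul'' hlt hlt zero_le_one zero_le_one]

theorem isoStar_le (hq : Admissible V H q) (x : PosCone Γ) :
    q.toSeminorm (of (isoStar x)) ≤ 1 := by
  have h : star (of (iso x)) = of (isoStar x : Gen A (PosCone Γ)) := star_of _
  rw [← h, q.map_star]
  exact hq.norm_iso_le x

end Admissible

theorem exists_bound (V H : PositiveAction A Γ) (b : FreeStar A (PosCone Γ)) :
    ∃ r : ℝ, ∀ q, Admissible V H q → q.toSeminorm b ≤ r := by
  induction b using FreeStar.induction with
  | hs c =>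
    refine ⟨‖c‖ * ‖(1 : A)‖, fun q hq => ?_⟩
    rw [Algebra.algebraMap_eq_smul_one, map_smul_eq_mul]
    refine mul_le_mul_of_nonneg_left ?_ (norm_nonneg _)
    rw [← q.norm_toCompl, ← toCompl_eq_of_sub q hq.el_one, q.norm_toCompl]
    exact hq.el_le 1
  | hg g =>
    cases g with
    | el a => exact ⟨‖a‖, fun q hq => hq.el_le a⟩
    | iso x => exact ⟨1, fun q hq => hq.norm_iso_le x⟩
    | isoStar x => exact ⟨1, fun q hq => hq.isoStar_le x⟩
  | hm a b ha hb =>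
    obtain ⟨r, hr⟩ := ha
    obtain ⟨s, hs⟩ := hb
    refine ⟨r * s, fun q hq => (q.mul_le' a b).trans ?_⟩
    exact mul_le_mul (hr q hq) (hs q hq) (apply_nonneg q.toSeminorm b)
      ((apply_nonneg q.toSeminorm a).trans (hr q hq))
  | ha a b ha hb =>
    obtain ⟨r, hr⟩ := ha
    obtain ⟨s, hs⟩ := hb
    exact ⟨r + s, fun q hq => (map_add_le_add q.toSeminorm a b).trans
      (add_le_add (hr q hq) (hs q hq))⟩

/-- The zero seminorm. -/
def zeroSeminorm (P : Type u) [Ring P] [Algebra ℂ P] [StarRing P] : CStarSeminorm P where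
  toSeminorm := 0
  mul_le' x y := by change (0 : ℝ) ≤ 0 * 0; simp
  star_mul_self' x := by change (0 : ℝ) = 0 * 0; simp

instance (V H : PositiveAction A Γ) : Nonempty {q // Admissible V H q} :=
  ⟨⟨zeroSeminorm _, by constructor <;> intros <;> rfl⟩⟩

theorem bddAbove_admissible (V H : PositiveAction A Γ) (b : FreeStar A (PosCone Γ)) :
    BddAbove (Set.range fun q : {q // Admissible V H q} => q.1.toSeminorm b) := by
  obtain ⟨r, hr⟩ := exists_bound V H b
  exact ⟨r, by rintro _ ⟨q, rfl⟩; exact hr q.1 q.2⟩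

theorem le_iSup_admissible {q : CStarSeminorm (FreeStar A (PosCone Γ))} (hq : Admissible V H q)
    (b : FreeStar A (PosCone Γ)) :
    q.toSeminorm b ≤ ⨆ q : {q // Admissible V H q}, q.1.toSeminorm b :=
  le_ciSup (bddAbove_admissible V H b) ⟨q, hq⟩

/-- The largest C⋆-seminorm on the free `*`-algebra that vanishes on the relations. -/
def universalSeminorm (V H : PositiveAction A Γ) : CStarSeminorm (FreeStar A (PosCone Γ)) where
  toFun b := ⨆ q : {q // Admissible V H q}, q.1.toSeminorm b
  map_zero' := by simp
  add_le' a b := ciSup_le fun q => (map_add_le_add q.1.toSeminorm a b).trans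
    (add_le_add (le_iSup_admissible q.2 a) (le_iSup_admissible q.2 b))
  neg' a := by simp
  smul' c a := by
    simp only [map_smul_eq_mul]
    exact (Real.mul_iSup_of_nonneg (norm_nonneg c) _).symm
  mul_le' a b := ciSup_le fun q => (q.1.mul_le' a b).trans
    (mul_le_mul (le_iSup_admissible q.2 a) (le_iSup_admissible q.2 b)
      (apply_nonneg q.1.toSeminorm b)
      (Real.iSup_nonneg fun q => apply_nonneg q.1.toSeminorm a))
  star_mul_self' a := by
    refine le_antisymm (ciSup_le fun q => ?_) ?_
    · rw [show q.1.toSeminorm (star a * a) = _ from q.1.star_mul_self' a]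
      exact mul_le_mul (le_iSup_admissible q.2 a) (le_iSup_admissible q.2 a)
        (apply_nonneg q.1.toSeminorm a)
        (Real.iSup_nonneg fun q => apply_nonneg q.1.toSeminorm a)
    · have h0 : 0 ≤ ⨆ q : {q // Admissible V H q}, q.1.toSeminorm (star a * a) :=
        Real.iSup_nonneg fun q => apply_nonneg q.1.toSeminorm _
      have h1 : (⨆ q : {q // Admissible V H q}, q.1.toSeminorm a) ≤
          √(⨆ q : {q // Admissible V H q}, q.1.toSeminorm (star a * a)) := by
        refine ciSup_le fun q => Real.le_sqrt_of_sq_le ?_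
        rw [sq, ← show q.1.toSeminorm (star a * a) = q.1.toSeminorm a * q.1.toSeminorm a from
          q.1.star_mul_self' a]
        exact le_iSup_admissible q.2 _
      exact (mul_self_le_mul_self
        (Real.iSup_nonneg fun q : {q // Admissible V H q} => apply_nonneg q.1.toSeminorm a)
        h1).trans_eq (Real.mul_self_sqrt h0)

theorem universalSeminorm_apply (V H : PositiveAction A Γ) (b : FreeStar A (PosCone Γ)) :
    (universalSeminorm V H).toSeminorm b = ⨆ q : {q // Admissible V H q}, q.1.toSeminorm b := rfl

theorem admissible_universalSeminorm (V H : PositiveAction A Γ) :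
    Admissible V H (universalSeminorm V H) := by
  have key : ∀ b : FreeStar A (PosCone Γ), (∀ q, Admissible V H q → q.toSeminorm b = 0) →
      (universalSeminorm V H).toSeminorm b = 0 := by
    intro b h
    rw [universalSeminorm_apply]
    simp [fun q : {q // Admissible V H q} => h q.1 q.2]
  constructor
  · exact fun a b => key _ fun q hq => hq.el_add a b
  · exact fun c a => key _ fun q hq => hq.el_smul c a
  · exact fun a b => key _ fun q hq => hq.el_mul a b
  · exact key _ fun q hq => hq.el_one
  · exact fun x => key _ fun q hq => hq.partial_isometry x
  · exact fun x a => key _ fun q hq => hq.rel_v x a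
  · exact fun x a => key _ fun q hq => hq.rel_h x a
  · exact fun x y => key _ fun q hq => hq.mul x y

/-- The crossed product `A ⋊_(V,H) Γ`: the universal unital C⋆-algebra generated by a copy of `A`
and partial isometries `U x`, `x ∈ Γ⁺`, subject to the relations `V x a = U x * a * (U x)⋆`,
`H x a = (U x)⋆ * a * U x` and `U x * U y = U (x + y)`. -/
abbrev CrossedProduct (V H : PositiveAction A Γ) : Type (max u v) :=
  (universalSeminorm V H).Compl

namespace CrossedProduct

/-- The canonical homomorphism from `A` to the crossed product. -/
def incl (V H : PositiveAction A Γ) : A →⋆ₐ[ℂ] CrossedProduct V H :=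
  (admissible_universalSeminorm V H).incl

/-- The canonical partial isometries in the crossed product. -/
def isom (V H : PositiveAction A Γ) (x : PosCone Γ) : CrossedProduct V H :=
  (universalSeminorm V H).toCompl (of (iso x))

theorem satisfiesRelations (V H : PositiveAction A Γ) :
    SatisfiesRelations V H (incl V H) (isom V H) :=
  (admissible_universalSeminorm V H).satisfiesRelations

/-- The `*`-subalgebra `C₀` of the crossed product generated by `A` and the partial isometries. -/
def core (V H : PositiveAction A Γ) : StarSubalgebra ℂ (CrossedProduct V H) :=
  StarAlgebra.adjoin ℂ (Set.range (incl V H) ∪ Set.range (isom V H))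

theorem toCompl_mem_core (V H : PositiveAction A Γ) (b : FreeStar A (PosCone Γ)) :
    (universalSeminorm V H).toCompl b ∈ core V H := by
  have hsub := StarAlgebra.subset_adjoin ℂ (Set.range (incl V H) ∪ Set.range (isom V H))
  have hiso : ∀ x, isom V H x ∈ core V H := fun x => hsub (Or.inr ⟨x, rfl⟩)
  induction b using FreeStar.induction with
  | hs c => rw [AlgHom.commutes]; exact algebraMap_mem _ c
  | hg g =>
    cases g with
    | el a => exact hsub (Or.inl ⟨a, rfl⟩)
    | iso x => exact hiso x
    | isoStar x =>
      have h : star (of (iso x)) = of (isoStar x : Gen A (PosCone Γ)) := star_of _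
      rw [← h, CStarSeminorm.toCompl_star]
      exact star_mem (hiso x)
  | hm a b ha hb => rw [map_mul]; exact mul_mem ha hb
  | ha a b ha hb => rw [map_add]; exact add_mem ha hb

theorem dense_core (V H : PositiveAction A Γ) : Dense (core V H : Set (CrossedProduct V H)) :=
  (universalSeminorm V H).denseRange_toCompl.mono
    (by rintro _ ⟨b, rfl⟩; exact toCompl_mem_core V H b)

/-- The universal property of the crossed product. -/
theorem existsUnique_lift (V H : PositiveAction A Γ) {C : Type w} [CStarAlgebra C]
    (σ : A →⋆ₐ[ℂ] C) (U : PosCone Γ → C) (h : SatisfiesRelations V H σ U) :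
    ∃! φ : CrossedProduct V H →⋆ₐ[ℂ] C, (∀ a, φ (incl V H a) = σ a) ∧
      ∀ x, φ (isom V H x) = U x := by
  set f : Gen A (PosCone Γ) → C := fun g => match g with
    | el a => σ a
    | iso x => U x
    | isoStar x => star (U x) with hf
  have hel : ∀ a, FreeStar.lift f (of (el a)) = σ a := fun a => lift_of f _
  have hiso : ∀ x, FreeStar.lift f (of (iso x)) = U x := fun x => lift_of f _
  have hisoStar : ∀ x, FreeStar.lift f (of (isoStar x)) = star (U x) := fun x => lift_of f _
  have hstar : ∀ b, FreeStar.lift f (star b) = star (FreeStar.lift f b) := by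
    intro b
    induction b using FreeStar.induction with
    | hs c =>
      rw [FreeStar.star_algebraMap, AlgHom.commutes, AlgHom.commutes, algebraMap_star_comm]
    | hg g =>
      rw [star_of]
      cases g with
      | el a => rw [Gen.adj, hel, hel, map_star]
      | iso x => rw [Gen.adj, hisoStar, hiso]
      | isoStar x => rw [Gen.adj, hiso, hisoStar, star_star]
    | hm a b ha hb => simp only [star_mul, map_mul, ha, hb]
    | ha a b ha hb => simp only [star_add, map_add, ha, hb]
  let q : CStarSeminorm (FreeStar A (PosCone Γ)) :=
    { toSeminorm := (normSeminorm ℂ C).comp (FreeStar.lift f).toLinearMap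
      mul_le' := fun x y => by
        change ‖FreeStar.lift f (x * y)‖ ≤ ‖FreeStar.lift f x‖ * ‖FreeStar.lift f y‖
        rw [map_mul]; exact norm_mul_le _ _
      star_mul_self' := fun x => by
        change ‖FreeStar.lift f (star x * x)‖ = ‖FreeStar.lift f x‖ * ‖FreeStar.lift f x‖
        rw [map_mul, hstar]; exact CStarRing.norm_star_mul_self }
  have hqa : ∀ b, q.toSeminorm b = ‖FreeStar.lift f b‖ := fun b => rfl
  have hq : Admissible V H q := by
    constructor
    · intro a b; simp [hqa, hel]
    · intro c a; simp [hqa, hel]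
    · intro a b; simp [hqa, hel]
    · simp [hqa, hel]
    · intro x; simp [hqa, hiso, hisoStar, h.partial_isometry]
    · intro x a; simp [hqa, hel, hiso, hisoStar, h.rel_v]
    · intro x a; simp [hqa, hel, hiso, hisoStar, h.rel_h]
    · intro x y; simp [hqa, hiso, h.mul]
  have hle : ∀ b, ‖FreeStar.lift f b‖ ≤ (universalSeminorm V H).toSeminorm b :=
    fun b => le_iSup_admissible hq b
  let f₀ : (universalSeminorm V H).Pre →+* C := (FreeStar.lift f).toRingHom
  have hf₀ : Continuous f₀ :=
    AddMonoidHomClass.continuous_of_bound f₀ 1 fun b => by rw [one_mul]; exact hle b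
  let g : CrossedProduct V H →+* C := UniformSpace.Completion.extensionHom f₀ hf₀
  have hg : ∀ b, g ((universalSeminorm V H).toCompl b) = FreeStar.lift f b := fun b =>
    UniformSpace.Completion.extensionHom_coe f₀ hf₀ b
  have hgc : Continuous g := UniformSpace.Completion.continuous_extension
  have hs := (universalSeminorm V H).continuous_star_compl
  refine ⟨{ g with
      commutes' := fun c => ?_
      map_star' := fun x => ?_ }, ⟨fun a => ?_, fun x => ?_⟩, ?_⟩
  · change g (algebraMap ℂ _ c) = _
    rw [← AlgHom.commutes (universalSeminorm V H).toCompl, hg, AlgHom.commutes]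
  · change g (star x) = star (g x)
    refine (universalSeminorm V H).induction_on x
      (isClosed_eq (hgc.comp hs) (continuous_star.comp hgc)) fun x => ?_
    rw [← CStarSeminorm.toCompl_star, hg, hg, hstar]
  · exact (hg _).trans (hel a)
  · exact (hg _).trans (hiso x)
  · rintro ψ ⟨h1, h2⟩
    have hψ : Continuous ψ := by
      refine AddMonoidHomClass.continuous_of_bound ψ 1 fun b => ?_
      rw [one_mul]; exact NonUnitalStarAlgHom.norm_apply_le ψ b
    ext x
    change ψ x = g x
    refine (universalSeminorm V H).induction_on x (isClosed_eq hψ hgc) fun b => ?_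
    rw [hg]
    induction b using FreeStar.induction with
    | hs c => rw [AlgHom.commutes, AlgHom.commutes, AlgHomClass.commutes]
    | hg e =>
      cases e with
      | el a => rw [hel]; exact h1 a
      | iso x => rw [hiso]; exact h2 x
      | isoStar x =>
        have h3 : star (of (iso x)) = of (isoStar x : Gen A (PosCone Γ)) := star_of _
        rw [← h3, CStarSeminorm.toCompl_star, map_star, hstar, hiso]
        exact congrArg star (h2 x)
    | hm a b ha hb => simp only [map_mul, ha, hb]
    | ha a b ha hb => simp only [map_add, ha, hb]

/-! ### Quasi-monomials and the degree-zero coefficient -/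

/-- The degree of the monomial `a₁ U_{x₁} ⋯ aₙ U_{xₙ}`. -/
def degree (l : List (A × PosCone Γ)) : PosCone Γ := (l.map Prod.snd).sum

/-- The monomial `a₁ U_{x₁} ⋯ aₙ U_{xₙ}` of positive type. -/
def posMonomial (V H : PositiveAction A Γ) (l : List (A × PosCone Γ)) : CrossedProduct V H :=
  (l.map fun p => incl V H p.1 * isom V H p.2).prod

/-- The monomial `a₁ U_{x₁}⋆ ⋯ aₙ U_{xₙ}⋆` of negative type. -/
def negMonomial (V H : PositiveAction A Γ) (l : List (A × PosCone Γ)) : CrossedProduct V H :=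
  (l.map fun p => incl V H p.1 * star (isom V H p.2)).prod

/-- `q` is a quasi-monomial of positive type and degree `x`: a finite sum of monomials of positive
type and degree `x`. -/
def IsPosQuasiMonomial (V H : PositiveAction A Γ) (x : PosCone Γ) (q : CrossedProduct V H) :
    Prop :=
  q ∈ AddSubmonoid.closure {m | ∃ l, l ≠ [] ∧ degree l = x ∧ m = posMonomial V H l}

/-- `q` is a quasi-monomial of negative type and degree `x`: a finite sum of monomials of negative
type and degree `x`. -/
def IsNegQuasiMonomial (V H : PositiveAction A Γ) (x : PosCone Γ) (q : CrossedProduct V H) :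
    Prop :=
  q ∈ AddSubmonoid.closure {m | ∃ l, l ≠ [] ∧ degree l = x ∧ m = negMonomial V H l}

/-- `E` maps every `∑_{x ∈ F} q₋ₓ + a₀ + ∑_{x ∈ F} qₓ`, where `F ⊆ Γ⁺ \ {0}` is finite and the
`q₋ₓ`, `qₓ` are quasi-monomials of degree `x` of negative and positive type, to its
coefficient `a₀ ∈ A`. -/
def ExtractsDegreeZero {V H : PositiveAction A Γ} (E : CrossedProduct V H →L[ℂ] A) : Prop :=
  ∀ (F : Finset (PosCone Γ)) (qneg qpos : PosCone Γ → CrossedProduct V H) (a₀ : A),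
    0 ∉ F → (∀ x ∈ F, IsNegQuasiMonomial V H x (qneg x)) →
    (∀ x ∈ F, IsPosQuasiMonomial V H x (qpos x)) →
    E (∑ x ∈ F, qneg x + incl V H a₀ + ∑ x ∈ F, qpos x) = a₀

/-- `E` is a conditional expectation of the crossed product onto (the copy of) `A`. -/
structure IsConditionalExpectation {V H : PositiveAction A Γ} (E : CrossedProduct V H →L[ℂ] A) :
    Prop where
  apply_incl : ∀ a, E (incl V H a) = a
  bimodule : ∀ a b c, E (incl V H a * c * incl V H b) = a * E c * b
  positive : ∀ c, ∃ b, E (star c * c) = star b * b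
  norm_le : ∀ c, ‖E c‖ ≤ ‖c‖

end CrossedProduct

end CrossedProduct

end Interaction

end

noncomputable section

namespace Interaction

open CrossedProduct

/-! ### Covariant representations and the embedding of `A` -/

section Covariance

variable {A : Type u} [CStarAlgebra A]
variable {Γ : Type v} [AddCommGroup Γ] [LinearOrder Γ] [IsOrderedAddMonoid Γ]
variable {V H : PositiveAction A Γ}

namespace IsCovariantRep

variable {C : Type w} [CStarAlgebra C] {σ : A →⋆ₐ[ℂ] C} {U : PosCone Γ → C}

/-! The expectation is the average over the dual group of `Γ`. The defining relations survive
replacing each `U x` by `χ(x) U x`, so the universal property yields an action of the compact dual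
that fixes `A` (`dualAction`). Its Haar average keeps the spectral subspace of degree zero and kills
all others (`average_of_mem_zero`, `average_of_mem`), because nontrivial characters integrate to
zero.

Two facts turn this average into a map onto `A`. First, `A` embeds: fine representability provides a
faithful covariant representation, and `map_h_one` forces the initial projection of `U x` to be the
image of `H x 1`, so this representation satisfies all relations of the crossed product and factors
through it (`incl_injective`). Secondly, since `Γ` is totally ordered, a product of a starred and an
unstarred isometry collapses to one type, so the core is spanned by monomials of pure type
(`mul_monomial_mem`, `mem_closure_monomials`), and those of degree zero lie in `A`. By density and
closedness of `A`, the average has values in `A`; density also gives uniqueness.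

For the norm formula, if `c` has components in a finite set `F` of degrees, the average of `c c⋆` is
the sum of the positive elements `f g * star (f g)`, which bounds every component; hence `‖c‖² ≤
|F|² ‖E (c c⋆)‖`. For `c = (a a⋆)^k` the left side is `‖a‖^(4k)`, while commutativity of `Γ` keeps
the number of degrees polynomial in `k`. The `4k`-th root removes this factor, and contractivity
gives the opposite bound. -/

theorem star_mul_mul_star (h : IsCovariantRep V σ U) (x : PosCone Γ) :
    star (U x) * U x * star (U x) = star (U x) := by
  simpa [mul_assoc] using congrArg star (h.partial_isometry x)

/-- The element `H x 1` is represented by the initial projection of `U x`. -/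
theorem map_h_one (h : IsCovariantRep V σ U) (hVH : IsCompleteInteraction V H) (x : PosCone Γ) :
    σ (H x 1) = star (U x) * U x := by
  -- The initial projection already lies in `σ(A)`. It remains to identify two projections of `A`,
  -- namely `p` and `H x 1`, by showing that each dominates the other.
  obtain ⟨p, hp⟩ : ∃ p, σ p = star (U x) * U x := by simpa using h.mem_range x 1
  have hU := h.partial_isometry x
  have hU' := h.star_mul_mul_star x
  set u := U x
  have hVq : V x (H x 1) = V x 1 * V x 1 := by simpa using hVH.v_h x 1
  have hσV1 : σ (V x 1) = u * star u := by simpa using h.cov x 1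
  have hV1 : V x 1 * V x 1 = V x 1 := by
    apply h.injective
    rw [map_mul, hσV1, mul_assoc, ← mul_assoc (star u), hU']
  rw [hV1] at hVq
  have hVp : V x p = V x 1 := by
    apply h.injective
    rw [h.cov, hp, hσV1, ← mul_assoc, hU]
  have hHH : H x 1 * H x 1 = H x 1 := by
    have h1 : H x (V x (H x 1)) = H x 1 := hVH.hvh x 1
    rw [hVq] at h1
    simpa [h1] using (hVH.h_v x 1).symm
  have hpp : p * p = p := by
    apply h.injective
    rw [map_mul, hp, mul_assoc, ← mul_assoc u, hU]
  have hps : star p = p := by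
    apply h.injective
    rw [map_star, hp, star_mul, star_star]
  have hHs : star (H x 1) = H x 1 := by
    obtain ⟨b, hb⟩ := H.positive' x 1
    rw [star_one, one_mul] at hb
    change H x 1 = _ at hb
    rw [hb, star_mul, star_star]
  -- `V x` is multiplicative against `H x 1` and sends both projections to `V x 1`; applying `H x`
  -- turns this into a compression by `H x 1`.
  have e1 : H x 1 * p * H x 1 = H x 1 := by
    have h1 : V x (H x 1 * p * H x 1) = V x 1 := by
      rw [hVH.v_mul x _ _ (Or.inr ⟨1, rfl⟩), hVH.v_mul x _ _ (Or.inl ⟨1, rfl⟩), hVq, hVp, hV1, hV1]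
    have h2 := hVH.h_v x (H x 1 * p * H x 1)
    rw [h1, hVH.h_v x 1, mul_one, hHH] at h2
    calc H x 1 * p * H x 1 = (H x 1 * H x 1) * p * (H x 1 * H x 1) := by rw [hHH]
      _ = H x 1 * (H x 1 * p * H x 1) * H x 1 := by simp only [mul_assoc]
      _ = H x 1 := h2.symm
  have e2 : p * H x 1 * p = p := by
    apply h.injective
    have h1 : σ (V x (H x 1)) = u * star u := by rw [hVq, hσV1]
    rw [h.cov] at h1
    rw [map_mul, map_mul, hp]
    calc star u * u * σ (H x 1) * (star u * u)
        = star u * (u * σ (H x 1) * star u) * u := by simp only [mul_assoc]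
      _ = star u * u := by rw [h1, ← mul_assoc, hU']
  -- For projections, `r s r = r` means `r ≤ s`: by the C⋆-identity `r - s r` vanishes, since its
  -- square is `r - r s r`.
  have aux : ∀ r s : A, star r = r → star s = s → r * r = r → s * s = s → r * s * r = r →
      s * r = r := by
    intro r s hr hs hrr hss hrsr
    have h1 : star (r - s * r) * (r - s * r) = 0 := by
      simp only [star_sub, star_mul, hr, hs]
      calc (r - r * s) * (r - s * r) = r * r - r * s * r - r * s * r + r * (s * s) * r := by
            noncomm_ring
        _ = 0 := by rw [hrr, hss, hrsr]; abel
    rw [CStarRing.star_mul_self_eq_zero_iff, sub_eq_zero] at h1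
    exact h1.symm
  have f1 := aux _ _ hHs hps hHH hpp e1
  have f2 := congrArg star (aux _ _ hps hHs hpp hHH e2)
  rw [star_mul, hps, hHs, f1] at f2
  rw [f2, hp]

/-- If `(V, H)` is a complete interaction, every covariant representation of `V` satisfies the
relations of the crossed product by `(V, H)`. -/
theorem satisfiesRelations (h : IsCovariantRep V σ U) (hVH : IsCompleteInteraction V H) :
    SatisfiesRelations V H σ U where
  partial_isometry := h.partial_isometry
  rel_v := h.cov
  rel_h x a := by
    have hU' := h.star_mul_mul_star x
    have hσV1 : σ (V x 1) = U x * star (U x) := by simpa using h.cov x 1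
    -- `H x a` lives in the corner of the initial projection, so it is recovered from its conjugate
    -- by `U x`, which is the image of `V x (H x a)` and hence the compression of `a` by the final
    -- projection.
    calc σ (H x a) = σ (H x 1 * H x a * H x 1) := by rw [← hVH.h_v, hVH.hvh]
      _ = star (U x) * (U x * σ (H x a) * star (U x)) * U x := by
        simp only [map_mul, h.map_h_one hVH, mul_assoc]
      _ = star (U x) * (U x * star (U x) * σ a * (U x * star (U x))) * U x := by
        rw [← h.cov, hVH.v_h, map_mul, map_mul, hσV1]
      _ = (star (U x) * U x * star (U x)) * σ a * (star (star (U x) * U x * star (U x))) := by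
        simp only [mul_assoc, star_mul, star_star]
      _ = _ := by rw [hU', star_star]
  mul x y := (h.map_add x y).symm

end IsCovariantRep

/-- A faithful covariant representation factors through the crossed product, so nothing in `A` can
be lost there. -/
theorem CrossedProduct.incl_injective (hV : FinelyRepresentable.{u, v, w} V)
    (hVH : IsCompleteInteraction V H) : Function.Injective (incl V H) := by
  obtain ⟨C, _, σ, U, h⟩ := hV
  obtain ⟨φ, ⟨hφ, -⟩, -⟩ := existsUnique_lift V H σ U (h.satisfiesRelations hVH)
  intro a b hab
  apply h.injective
  rw [← hφ, ← hφ, hab]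

end Covariance

/-! ### Monomials span the core -/

section Monomials

/-- If `i 1 = 1`, `W` and `W'` are additive and `W' x * i a * W x` is in the range of `i`, then the
product of `W' x * i b` with a monomial in `W` belongs to every set that contains the monomials
in `W` and in `W'`. -/
theorem mul_monomial_mem {A : Type u} {B : Type w} {Γ : Type v} [Ring A] [Ring B]
    [AddCommGroup Γ] [LinearOrder Γ] [IsOrderedAddMonoid Γ] (i : A →+* B) (W W' : PosCone Γ → B)
    (hW0 : W' 0 = 1) (hW : ∀ x y, W (x + y) = W x * W y) (hW' : ∀ x y, W' (x + y) = W' x * W' y)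
    (hc : ∀ x a, ∃ b, W' x * i a * W x = i b) (S : Set B)
    (hS : ∀ l : List (A × PosCone Γ), (l.map fun p => i p.1 * W p.2).prod ∈ S)
    (hS' : ∀ l : List (A × PosCone Γ), (l.map fun p => i p.1 * W' p.2).prod ∈ S)
    (l : List (A × PosCone Γ)) (x : PosCone Γ) (b : A) :
    W' x * i b * (l.map fun p => i p.1 * W p.2).prod ∈ S := by
  induction l generalizing x b with
  | nil =>
    -- The coefficient `b` stands to the right of `W' x`; a further letter of exponent zero
    -- accommodates it.
    convert hS' [(1, x), (b, 0)] using 1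
    simp [hW0]
  | cons p l ih =>
    obtain ⟨a, y⟩ := p
    -- Totality of the order enters here: the smaller exponent is absorbed into a coefficient. If `x
    -- ≤ y` a pure `W`-monomial remains; otherwise a shorter product of the original shape does,
    -- with a new exponent and coefficient.
    rcases le_total x y with hxy | hxy
    · obtain ⟨z, rfl⟩ : ∃ z : PosCone Γ, y = x + z :=
        ⟨⟨y.1 - x.1, sub_nonneg.2 hxy⟩, Subtype.ext (by simp)⟩
      obtain ⟨c, hc⟩ := hc x (b * a)
      convert hS ((c, z) :: l) using 1
      simp only [List.map_cons, List.prod_cons, ← hc, hW, map_mul, mul_assoc]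
    · obtain ⟨z, rfl⟩ : ∃ z : PosCone Γ, x = z + y :=
        ⟨⟨x.1 - y.1, sub_nonneg.2 hxy⟩, Subtype.ext (by simp)⟩
      obtain ⟨c, hc⟩ := hc y (b * a)
      convert ih z c using 1
      simp only [List.map_cons, List.prod_cons, ← hc, hW', map_mul, mul_assoc]

variable {A : Type u} [CStarAlgebra A]
variable {Γ : Type v} [AddCommGroup Γ] [LinearOrder Γ] [IsOrderedAddMonoid Γ]
variable (V H : PositiveAction A Γ)

namespace CrossedProduct

theorem isom_add (x y : PosCone Γ) : isom V H (x + y) = isom V H x * isom V H y :=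
  ((satisfiesRelations V H).mul x y).symm

/-- `U 0` is idempotent by additivity and a coisometry because `V 0 1 = 1`; cancelling its adjoint
leaves `1`. -/
theorem isom_zero : isom V H 0 = 1 := by
  have h := satisfiesRelations V H
  have h1 : isom V H 0 * star (isom V H 0) = 1 := by
    simpa [show V 0 1 = 1 from V.zero' 1] using (h.rel_v 0 1).symm
  have h2 := congrArg (· * star (isom V H 0)) (h.mul 0 0)
  simpa [mul_assoc, h1] using h2

theorem star_isom_add (x y : PosCone Γ) :
    star (isom V H (x + y)) = star (isom V H x) * star (isom V H y) := by
  rw [add_comm, isom_add, star_mul]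

/-- All monomials of positive or negative type, including those of degree zero. -/
def monomials : Set (CrossedProduct V H) :=
  Set.range (posMonomial V H) ∪ Set.range (negMonomial V H)

variable {V H}

theorem incl_mem_monomials (a : A) : incl V H a ∈ monomials V H :=
  Or.inl ⟨[(a, 0)], by simp [posMonomial, isom_zero]⟩

theorem incl_mul_mem_monomials (a : A) {m : CrossedProduct V H} (hm : m ∈ monomials V H) :
    incl V H a * m ∈ monomials V H := by
  rcases hm with ⟨l, rfl⟩ | ⟨l, rfl⟩
  · cases l with
    | nil => simpa [posMonomial] using incl_mem_monomials a
    | cons p l => exact Or.inl ⟨(a * p.1, p.2) :: l, by simp [posMonomial, mul_assoc]⟩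
  · cases l with
    | nil => simpa [negMonomial] using incl_mem_monomials a
    | cons p l => exact Or.inr ⟨(a * p.1, p.2) :: l, by simp [negMonomial, mul_assoc]⟩

theorem isom_mul_mem_monomials (x : PosCone Γ) {m : CrossedProduct V H}
    (hm : m ∈ monomials V H) : isom V H x * m ∈ monomials V H := by
  rcases hm with ⟨l, rfl⟩ | ⟨l, rfl⟩
  · exact Or.inl ⟨(1, x) :: l, by simp [posMonomial]⟩
  · simpa [posMonomial, negMonomial] using mul_monomial_mem (incl V H : A →+* CrossedProduct V H)
      (fun x => star (isom V H x)) (isom V H) (isom_zero V H) (star_isom_add V H) (isom_add V H)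
      (fun x a => ⟨V x a, ((satisfiesRelations V H).rel_v x a).symm⟩) (monomials V H)
      (fun l => Or.inr ⟨l, rfl⟩) (fun l => Or.inl ⟨l, rfl⟩) l x 1

theorem star_isom_mul_mem_monomials (x : PosCone Γ) {m : CrossedProduct V H}
    (hm : m ∈ monomials V H) : star (isom V H x) * m ∈ monomials V H := by
  rcases hm with ⟨l, rfl⟩ | ⟨l, rfl⟩
  · simpa [posMonomial, negMonomial] using mul_monomial_mem (incl V H : A →+* CrossedProduct V H)
      (isom V H) (fun x => star (isom V H x)) (by simp [isom_zero]) (isom_add V H)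
      (star_isom_add V H)
      (fun x a => ⟨H x a, ((satisfiesRelations V H).rel_h x a).symm⟩) (monomials V H)
      (fun l => Or.inl ⟨l, rfl⟩) (fun l => Or.inr ⟨l, rfl⟩) l x 1
  · exact Or.inr ⟨(1, x) :: l, by simp [negMonomial]⟩

/-- Left multiplication by each generator or its adjoint preserves the set of monomials, so the
additive span is a left module over the core containing `1`. Scalars need no separate treatment, as
they are absorbed into coefficients from `A`. -/
theorem mem_closure_monomials {c : CrossedProduct V H} (hc : c ∈ core V H) :
    c ∈ AddSubmonoid.closure (monomials V H) := by
  let T := AddSubmonoid.closure (monomials V H)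
  have hT : ∀ b : CrossedProduct V H, (∀ m ∈ monomials V H, b * m ∈ monomials V H) →
      ∀ t ∈ T, b * t ∈ T := by
    intro b hb t ht
    induction ht using AddSubmonoid.closure_induction with
    | mem m hm => exact AddSubmonoid.subset_closure (hb m hm)
    | zero => rw [mul_zero]; exact T.zero_mem
    | add s t _ _ hs ht => rw [mul_add]; exact T.add_mem hs ht
  suffices h : ∀ t ∈ T, c * t ∈ T by
    simpa using h 1 (AddSubmonoid.subset_closure
      (by simpa using incl_mem_monomials (V := V) (H := H) 1))
  change c ∈ (core V H).toSubalgebra at hc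
  rw [core, StarAlgebra.adjoin_toSubalgebra] at hc
  induction hc using Algebra.adjoin_induction with
  | mem b hb =>
    refine hT b fun m hm => ?_
    rcases hb with (⟨a, rfl⟩ | ⟨x, rfl⟩) | hb
    · exact incl_mul_mem_monomials a hm
    · exact isom_mul_mem_monomials x hm
    · rw [← star_star b]
      rcases Set.mem_star.1 hb with ⟨a, ha⟩ | ⟨x, hx⟩
      · rw [← ha, ← map_star]; exact incl_mul_mem_monomials _ hm
      · rw [← hx]; exact star_isom_mul_mem_monomials x hm
  | algebraMap r =>
    refine hT _ fun m hm => ?_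
    rw [← AlgHomClass.commutes (incl V H)]
    exact incl_mul_mem_monomials _ hm
  | add a b _ _ ha hb => intro t ht; rw [add_mul]; exact T.add_mem (ha t ht) (hb t ht)
  | mul a b _ _ ha hb => intro t ht; rw [mul_assoc]; exact ha _ (hb t ht)

/-- In a monomial of degree zero all exponents vanish. -/
theorem eq_zero_of_degree_eq_zero {A : Type u} {l : List (A × PosCone Γ)} (hl : degree l = 0)
    {p : A × PosCone Γ} (hp : p ∈ l) : p.2 = 0 := by
  induction l with
  | nil => simp at hp
  | cons q l ih =>
    have h : (q.2 : Γ) + (degree l : Γ) = 0 := congrArg Subtype.val hl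
    obtain ⟨h1, h2⟩ := (add_eq_zero_iff_of_nonneg q.2.2 (degree l).2).1 h
    rcases List.mem_cons.1 hp with rfl | hp
    · exact Subtype.ext h1
    · exact ih (Subtype.ext h2) hp

theorem posMonomial_mem_range {l : List (A × PosCone Γ)} (hl : degree l = 0) :
    posMonomial V H l ∈ (incl V H).range := by
  refine list_prod_mem fun m hm => ?_
  obtain ⟨p, hp, rfl⟩ := List.mem_map.1 hm
  rw [eq_zero_of_degree_eq_zero hl hp, isom_zero, mul_one]
  exact ⟨_, rfl⟩

theorem negMonomial_mem_range {l : List (A × PosCone Γ)} (hl : degree l = 0) :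
    negMonomial V H l ∈ (incl V H).range := by
  refine list_prod_mem fun m hm => ?_
  obtain ⟨p, hp, rfl⟩ := List.mem_map.1 hm
  rw [eq_zero_of_degree_eq_zero hl hp, isom_zero, star_one, mul_one]
  exact ⟨_, rfl⟩

/-- A property of the elements of the core that is additive, holds on `A` and on the monomials of
non-zero degree holds on the core. -/
theorem core_induction {p : CrossedProduct V H → Prop} (hA : ∀ a, p (incl V H a))
    (hpos : ∀ l, degree l ≠ 0 → p (posMonomial V H l))
    (hneg : ∀ l, degree l ≠ 0 → p (negMonomial V H l))
    (hadd : ∀ b c, p b → p c → p (b + c)) {c : CrossedProduct V H} (hc : c ∈ core V H) : p c := by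
  replace hc := mem_closure_monomials hc
  induction hc using AddSubmonoid.closure_induction with
  | mem m hm =>
    rcases hm with ⟨l, rfl⟩ | ⟨l, rfl⟩
    -- The exponents are nonnegative, so total degree zero leaves only coefficients, and the
    -- monomial belongs to `A`.
    · by_cases hl : degree l = 0
      · obtain ⟨a, ha⟩ := posMonomial_mem_range (V := V) (H := H) hl
        exact ha ▸ hA a
      · exact hpos l hl
    · by_cases hl : degree l = 0
      · obtain ⟨a, ha⟩ := negMonomial_mem_range (V := V) (H := H) hl
        exact ha ▸ hA a
      · exact hneg l hl
  | zero => simpa using hA 0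
  | add b c _ _ hb hc => exact hadd b c hb hc

/-- A continuous linear map that extracts the coefficient of degree zero is unique. -/
theorem ExtractsDegreeZero.eq {E E' : CrossedProduct V H →L[ℂ] A} (hE : ExtractsDegreeZero E)
    (hE' : ExtractsDegreeZero E') : E = E' := by
  have key : ∀ {E : CrossedProduct V H →L[ℂ] A}, ExtractsDegreeZero E →
      (∀ a, E (incl V H a) = a) ∧ (∀ l, degree l ≠ 0 → E (posMonomial V H l) = 0) ∧
      ∀ l, degree l ≠ 0 → E (negMonomial V H l) = 0 := by
    intro E hE
    have hne : ∀ l : List (A × PosCone Γ), degree l ≠ 0 → l ≠ [] := by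
      rintro _ h rfl; exact h rfl
    refine ⟨fun a => ?_, fun l hl => ?_, fun l hl => ?_⟩
    · simpa using hE ∅ 0 0 a (by simp) (by simp) (by simp)
    · simpa using hE {degree l} 0 (fun _ => posMonomial V H l) 0 (by simpa using hl.symm)
        (fun x _ => zero_mem _) fun x hx => AddSubmonoid.subset_closure
          ⟨l, hne l hl, (Finset.mem_singleton.1 hx).symm, rfl⟩
    · simpa using hE {degree l} (fun _ => negMonomial V H l) 0 0 (by simpa using hl.symm)
        (fun x hx => AddSubmonoid.subset_closure
          ⟨l, hne l hl, (Finset.mem_singleton.1 hx).symm, rfl⟩) fun x _ => zero_mem _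
  obtain ⟨h1, h2, h3⟩ := key hE
  obtain ⟨h1', h2', h3'⟩ := key hE'
  refine ContinuousLinearMap.ext_on (s := (core V H : Set (CrossedProduct V H)))
    ((dense_core V H).mono Submodule.subset_span) fun c hc => ?_
  exact core_induction (p := fun c => E c = E' c) (fun a => (h1 a).trans (h1' a).symm)
    (fun l hl => (h2 l hl).trans (h2' l hl).symm) (fun l hl => (h3 l hl).trans (h3' l hl).symm)
    (fun b c hb hc => by rw [map_add, map_add, hb, hc]) hc

end CrossedProduct

end Monomials

/-! ### The dual group -/

section Dual

/-- The group `Γ`, written multiplicatively and with the discrete topology. -/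
def Discrete (Γ : Type v) : Type v := Multiplicative Γ

variable (Γ : Type v) [AddCommGroup Γ]

instance : CommGroup (Discrete Γ) := inferInstanceAs (CommGroup (Multiplicative Γ))

instance : TopologicalSpace (Discrete Γ) := ⊥

instance : DiscreteTopology (Discrete Γ) := ⟨rfl⟩

/-- The compact group of characters of the discrete group `Γ`. -/
abbrev Dual : Type v := PontryaginDual (Discrete Γ)

instance : MeasurableSpace (Dual Γ) := borel _

instance : BorelSpace (Dual Γ) := ⟨rfl⟩

/-- The normalized Haar measure on the dual group. -/
def dualHaar : MeasureTheory.Measure (Dual Γ) := MeasureTheory.Measure.haarMeasure ⊤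

instance : (dualHaar Γ).IsMulLeftInvariant :=
  inferInstanceAs (MeasureTheory.Measure.haarMeasure ⊤).IsMulLeftInvariant

instance : MeasureTheory.IsProbabilityMeasure (dualHaar Γ) :=
  ⟨MeasureTheory.Measure.haarMeasure_self
    (K₀ := (⊤ : TopologicalSpace.PositiveCompacts (Dual Γ)))⟩

variable {Γ}

/-- The value at `x` of a character, as a complex number. -/
def char (x : Γ) (χ : Dual Γ) : ℂ := (χ (Multiplicative.ofAdd x : Multiplicative Γ) : Circle)

theorem char_zero (χ : Dual Γ) : char 0 χ = 1 :=
  congrArg (fun z : Circle => (z : ℂ)) (map_one χ)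

theorem char_add (x y : Γ) (χ : Dual Γ) : char (x + y) χ = char x χ * char y χ :=
  congrArg (fun z : Circle => (z : ℂ)) (map_mul χ _ _)

theorem char_neg (x : Γ) (χ : Dual Γ) : char (-x) χ = star (char x χ) :=
  (congrArg (fun z : Circle => (z : ℂ)) (map_inv χ _)).trans (Circle.coe_inv_eq_conj _)

theorem char_mul (x : Γ) (χ ψ : Dual Γ) : char x (χ * ψ) = char x χ * char x ψ := rfl

theorem star_char_mul_self (x : Γ) (χ : Dual Γ) : star (char x χ) * char x χ = 1 := by
  rw [← char_neg, ← char_add, neg_add_cancel, char_zero]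

theorem continuous_char (x : Γ) : Continuous (char x) :=
  continuous_induced_dom.comp
    ((continuous_eval_const (F := C(Discrete Γ, Circle))
      (Multiplicative.ofAdd x : Multiplicative Γ)).comp
      (ContinuousMonoidHom.isInducing_toContinuousMap (Discrete Γ) Circle).continuous)

/-- The embedding of `ℚ / ℤ` into the circle. -/
def ratCircle : AddCircle (1 : ℚ) →+ Additive Circle :=
  QuotientAddGroup.lift _
    { toFun := fun r : ℚ => Additive.ofMul (Circle.exp (2 * Real.pi * (r : ℝ)))
      map_zero' := by simp
      map_add' := fun r s => by simp [mul_add, Circle.exp_add] }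
    (by
      intro r hr
      obtain ⟨n, rfl⟩ := AddSubgroup.mem_zmultiples_iff.1 hr
      have h : 2 * Real.pi * (((n • (1 : ℚ) : ℚ)) : ℝ) = n * (2 * Real.pi) := by
        push_cast [zsmul_eq_mul]; ring
      change Additive.ofMul (Circle.exp _) = 0
      rw [h, Circle.exp_int_mul_two_pi]; rfl)

theorem ratCircle_ne_zero {t : AddCircle (1 : ℚ)} (ht : t ≠ 0) : ratCircle t ≠ 0 := by
  obtain ⟨r, rfl⟩ := QuotientAddGroup.mk_surjective t
  intro h
  refine ht ((QuotientAddGroup.eq_zero_iff r).2 ?_)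
  have h1 : Circle.exp (2 * Real.pi * (r : ℝ)) = 1 := h
  obtain ⟨n, hn⟩ := Circle.exp_eq_one.1 h1
  refine AddSubgroup.mem_zmultiples_iff.2 ⟨n, ?_⟩
  have hpi : (2 * Real.pi) ≠ 0 := by positivity
  have h2 : (r : ℝ) = n := mul_left_cancel₀ hpi (by rw [hn, mul_comm])
  rw [zsmul_eq_mul, mul_one]
  exact_mod_cast h2.symm

/-- Characters separate the points of `Γ`. -/
theorem exists_char_ne_one {x : Γ} (hx : x ≠ 0) : ∃ χ : Dual Γ, char x χ ≠ 1 := by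
  -- Homomorphisms to the divisible group `ℚ / ℤ` separate points, and `ratCircle` is injective;
  -- discreteness makes the composite continuous.
  obtain ⟨c, hc⟩ := CharacterModule.exists_character_apply_ne_zero_of_ne_zero hx
  let f : Γ →+ Additive Circle := ratCircle.comp c
  let χ : Dual Γ :=
    ⟨(AddMonoidHom.toMultiplicativeLeft f : Multiplicative Γ →* Circle),
      continuous_of_discreteTopology⟩
  refine ⟨χ, fun h => ratCircle_ne_zero hc ?_⟩
  exact Circle.ext h

/-- Translation by a character `ψ` with `ψ(x) ≠ 1` multiplies the integral by `ψ(x)` without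
changing it. -/
theorem integral_char {x : Γ} (hx : x ≠ 0) : ∫ χ, char x χ ∂(dualHaar Γ) = 0 := by
  obtain ⟨ψ, hψ⟩ := exists_char_ne_one hx
  have h := MeasureTheory.integral_mul_left_eq_self (μ := dualHaar Γ) (char x) ψ
  simp only [char_mul] at h
  rw [MeasureTheory.integral_const_mul] at h
  exact by_contra fun h0 => hψ ((mul_eq_right₀ h0).1 h)

end Dual

/-! ### The dual action -/

section DualAction

variable {A : Type u} [CStarAlgebra A]
variable {Γ : Type v} [AddCommGroup Γ] [LinearOrder Γ] [IsOrderedAddMonoid Γ]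

/-- The constant functions with values in `B`, as a `*`-homomorphism. -/
def constHom (G : Type v) [TopologicalSpace G] [CompactSpace G] (B : Type u) [CStarAlgebra B] :
    B →⋆ₐ[ℂ] C(G, B) where
  toFun b := ContinuousMap.const G b
  map_one' := rfl
  map_mul' _ _ := rfl
  map_zero' := rfl
  map_add' _ _ := rfl
  commutes' _ := rfl
  map_star' _ := rfl

/-- The functions `χ ↦ χ(x) U x`. -/
def twistedIsom (V H : PositiveAction A Γ) (x : PosCone Γ) : C(Dual Γ, CrossedProduct V H) where
  toFun χ := char (x : Γ) χ • isom V H x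
  continuous_toFun := (continuous_char _).smul continuous_const

/-- The unimodular factors cancel in the relations involving adjoints and multiply correctly in the
semigroup law. Working in continuous functions on the dual group treats all characters at once and
makes the orbit maps continuous automatically. -/
theorem satisfiesRelations_twistedIsom (V H : PositiveAction A Γ) :
    SatisfiesRelations V H ((constHom (Dual Γ) (CrossedProduct V H)).comp (incl V H))
      (twistedIsom V H) := by
  have h := satisfiesRelations V H
  constructor
  · intro x
    ext χ
    change char (x : Γ) χ • isom V H x * star (char (x : Γ) χ • isom V H x) *
      (char (x : Γ) χ • isom V H x) = char (x : Γ) χ • isom V H x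
    rw [star_smul, mul_assoc, smul_mul_smul_comm, star_char_mul_self, one_smul, smul_mul_assoc,
      ← mul_assoc, h.partial_isometry]
  · intro x a
    ext χ
    change incl V H (V x a) = char (x : Γ) χ • isom V H x * incl V H a *
      star (char (x : Γ) χ • isom V H x)
    rw [star_smul, smul_mul_assoc, smul_mul_smul_comm, mul_comm, star_char_mul_self, one_smul,
      h.rel_v]
  · intro x a
    ext χ
    change incl V H (H x a) = star (char (x : Γ) χ • isom V H x) * incl V H a *
      (char (x : Γ) χ • isom V H x)
    rw [star_smul, smul_mul_assoc, smul_mul_smul_comm, star_char_mul_self, one_smul, h.rel_h]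
  · intro x y
    ext χ
    change char (x : Γ) χ • isom V H x * char (y : Γ) χ • isom V H y =
      char ((x + y : PosCone Γ) : Γ) χ • isom V H (x + y)
    rw [smul_mul_smul_comm, h.mul]
    exact congrArg (· • _) (char_add _ _ χ).symm

/-- The dual action: `dualAction V H c χ` is the image of `c` under the automorphism that fixes `A`
and maps `U x` to `χ(x) U x`. -/
def dualAction (V H : PositiveAction A Γ) :
    CrossedProduct V H →⋆ₐ[ℂ] C(Dual Γ, CrossedProduct V H) :=
  (existsUnique_lift V H _ _ (satisfiesRelations_twistedIsom V H)).choose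

variable {V H : PositiveAction A Γ}

theorem dualAction_incl (a : A) (χ : Dual Γ) : dualAction V H (incl V H a) χ = incl V H a :=
  DFunLike.congr_fun
    ((existsUnique_lift V H _ _ (satisfiesRelations_twistedIsom V H)).choose_spec.1.1 a) χ

theorem dualAction_isom (x : PosCone Γ) (χ : Dual Γ) :
    dualAction V H (isom V H x) χ = char (x : Γ) χ • isom V H x :=
  DFunLike.congr_fun
    ((existsUnique_lift V H _ _ (satisfiesRelations_twistedIsom V H)).choose_spec.1.2 x) χ

theorem norm_dualAction_apply_le (c : CrossedProduct V H) (χ : Dual Γ) :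
    ‖dualAction V H c χ‖ ≤ ‖c‖ :=
  (ContinuousMap.norm_coe_le_norm _ χ).trans (NonUnitalStarAlgHom.norm_apply_le (dualAction V H) c)

theorem integrable_dualAction (c : CrossedProduct V H) :
    MeasureTheory.Integrable (dualAction V H c) (dualHaar Γ) :=
  (dualAction V H c).continuous.integrable_of_hasCompactSupport
    (HasCompactSupport.of_compactSpace _)

/-! ### Spectral subspaces -/

variable (V H) in
/-- The spectral subspace of degree `g` of the dual action. -/
def spectralSubspace (g : Γ) : Submodule ℂ (CrossedProduct V H) where
  carrier := {c | ∀ χ, dualAction V H c χ = char g χ • c}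
  zero_mem' χ := by rw [map_zero, smul_zero]; rfl
  add_mem' {b c} hb hc χ := by
    rw [map_add, ContinuousMap.add_apply, hb, hc, smul_add]
  smul_mem' r c hc χ := by
    rw [map_smul, ContinuousMap.smul_apply, hc, smul_comm]

theorem mul_mem_spectralSubspace {g h : Γ} {b c : CrossedProduct V H}
    (hb : b ∈ spectralSubspace V H g) (hc : c ∈ spectralSubspace V H h) :
    b * c ∈ spectralSubspace V H (g + h) := fun χ => by
  rw [map_mul, ContinuousMap.mul_apply, hb, hc, smul_mul_smul_comm, char_add]

theorem star_mem_spectralSubspace {g : Γ} {c : CrossedProduct V H}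
    (hc : c ∈ spectralSubspace V H g) : star c ∈ spectralSubspace V H (-g) := fun χ => by
  rw [map_star, ContinuousMap.star_apply, hc, star_smul, char_neg]

theorem incl_mem_spectralSubspace (a : A) : incl V H a ∈ spectralSubspace V H 0 := fun χ => by
  rw [dualAction_incl, char_zero, one_smul]

theorem isom_mem_spectralSubspace (x : PosCone Γ) : isom V H x ∈ spectralSubspace V H (x : Γ) :=
  fun χ => dualAction_isom x χ

theorem posMonomial_mem_spectralSubspace (l : List (A × PosCone Γ)) :
    posMonomial V H l ∈ spectralSubspace V H (degree l : Γ) := by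
  induction l with
  | nil => simpa [posMonomial, degree] using incl_mem_spectralSubspace (V := V) (H := H) 1
  | cons p l ih =>
    have h := mul_mem_spectralSubspace (mul_mem_spectralSubspace
      (incl_mem_spectralSubspace p.1) (isom_mem_spectralSubspace p.2)) ih
    rwa [zero_add] at h

theorem negMonomial_mem_spectralSubspace (l : List (A × PosCone Γ)) :
    negMonomial V H l ∈ spectralSubspace V H (-(degree l : Γ)) := by
  induction l with
  | nil => simpa [negMonomial, degree] using incl_mem_spectralSubspace (V := V) (H := H) 1
  | cons p l ih =>
    have h := mul_mem_spectralSubspace (mul_mem_spectralSubspace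
      (incl_mem_spectralSubspace p.1)
      (star_mem_spectralSubspace (isom_mem_spectralSubspace p.2))) ih
    rw [zero_add, ← neg_add] at h
    exact h

theorem IsPosQuasiMonomial.mem_spectralSubspace {x : PosCone Γ} {q : CrossedProduct V H}
    (hq : IsPosQuasiMonomial V H x q) : q ∈ spectralSubspace V H (x : Γ) := by
  refine (AddSubmonoid.closure_le (S := (spectralSubspace V H (x : Γ)).toAddSubmonoid)).2 ?_ hq
  rintro _ ⟨l, -, rfl, rfl⟩
  exact posMonomial_mem_spectralSubspace l

theorem IsNegQuasiMonomial.mem_spectralSubspace {x : PosCone Γ} {q : CrossedProduct V H}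
    (hq : IsNegQuasiMonomial V H x q) : q ∈ spectralSubspace V H (-(x : Γ)) := by
  refine (AddSubmonoid.closure_le (S := (spectralSubspace V H (-(x : Γ))).toAddSubmonoid)).2 ?_ hq
  rintro _ ⟨l, -, rfl, rfl⟩
  exact negMonomial_mem_spectralSubspace l

/-! ### The average of the dual action -/

theorem norm_integral_dualAction_le (c : CrossedProduct V H) :
    ‖∫ χ, dualAction V H c χ ∂(dualHaar Γ)‖ ≤ ‖c‖ := by
  simpa using MeasureTheory.norm_integral_le_of_norm_le_const (μ := dualHaar Γ)
    (Filter.Eventually.of_forall (norm_dualAction_apply_le c))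

variable (V H) in
/-- The average of the dual action with respect to Haar measure. -/
def average : CrossedProduct V H →L[ℂ] CrossedProduct V H :=
  LinearMap.mkContinuous
    { toFun := fun c => ∫ χ, dualAction V H c χ ∂(dualHaar Γ)
      map_add' := fun b c => by
        simp only [map_add, ContinuousMap.add_apply]
        exact MeasureTheory.integral_add (integrable_dualAction b) (integrable_dualAction c)
      map_smul' := fun r c => by
        simp only [map_smul, ContinuousMap.smul_apply]
        exact MeasureTheory.integral_smul r _ } 1
    fun c => by rw [one_mul]; exact norm_integral_dualAction_le c

theorem average_apply (c : CrossedProduct V H) :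
    average V H c = ∫ χ, dualAction V H c χ ∂(dualHaar Γ) := rfl

theorem norm_average_le (c : CrossedProduct V H) : ‖average V H c‖ ≤ ‖c‖ :=
  norm_integral_dualAction_le c

theorem average_of_mem_zero {c : CrossedProduct V H} (hc : c ∈ spectralSubspace V H 0) :
    average V H c = c := by
  rw [average_apply, MeasureTheory.integral_congr_ae (g := fun _ => c)
    (Filter.Eventually.of_forall fun χ => by simp only [hc χ, char_zero, one_smul])]
  simp

theorem average_of_mem {g : Γ} (hg : g ≠ 0) {c : CrossedProduct V H}
    (hc : c ∈ spectralSubspace V H g) : average V H c = 0 := by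
  rw [average_apply, MeasureTheory.integral_congr_ae (g := fun χ => char g χ • c)
    (Filter.Eventually.of_forall fun χ => hc χ), integral_smul_const, integral_char hg, zero_smul]

/-- The dual action fixes `A`, and bounded multiplication operators pass through the integral. -/
theorem average_mul_incl (a b : A) (c : CrossedProduct V H) :
    average V H (incl V H a * c * incl V H b) = incl V H a * average V H c * incl V H b := by
  let T : CrossedProduct V H →L[ℂ] CrossedProduct V H :=
    ((ContinuousLinearMap.mul ℂ _).flip (incl V H b)).comp
      (ContinuousLinearMap.mul ℂ _ (incl V H a))
  have h := T.integral_comp_comm (integrable_dualAction c)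
  change ∫ χ, incl V H a * dualAction V H c χ * incl V H b ∂_ = _ at h
  rw [average_apply, average_apply]
  refine Eq.trans ?_ h
  simp only [map_mul, ContinuousMap.mul_apply, dualAction_incl]

theorem degree_coe_ne_zero {A : Type u} {l : List (A × PosCone Γ)} (hl : degree l ≠ 0) :
    (degree l : Γ) ≠ 0 := fun h => hl (Subtype.ext h)

/-- An injective `*`-homomorphism is isometric, so the copy of `A` is closed and it suffices to
check the dense core, where `core_induction` reduces to `A` and monomials of nonzero degree. -/
theorem average_mem_range (hi : Function.Injective (incl V H)) (c : CrossedProduct V H) :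
    average V H c ∈ Set.range (incl V H) := by
  have hiso : Isometry (incl V H) := NonUnitalStarAlgHom.isometry (incl V H) hi
  have hcl : IsClosed {c | average V H c ∈ Set.range (incl V H)} :=
    hiso.isClosedEmbedding.isClosed_range.preimage (average V H).continuous
  refine (dense_core V H).induction (P := fun c => average V H c ∈ Set.range (incl V H))
    (fun c hc => ?_) hcl c
  refine core_induction (p := fun c => average V H c ∈ Set.range (incl V H)) (fun a => ?_)
    (fun l hl => ?_) (fun l hl => ?_) ?_ hc
  · exact ⟨a, (average_of_mem_zero (incl_mem_spectralSubspace a)).symm⟩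
  · exact ⟨0, by rw [map_zero, average_of_mem (degree_coe_ne_zero hl)
      (posMonomial_mem_spectralSubspace l)]⟩
  · exact ⟨0, by rw [map_zero, average_of_mem (neg_ne_zero.2 (degree_coe_ne_zero hl))
      (negMonomial_mem_spectralSubspace l)]⟩
  · rintro b c ⟨x, hx⟩ ⟨y, hy⟩
    exact ⟨x + y, by rw [map_add, map_add, hx, hy]⟩

end DualAction

/-! ### The conditional expectation -/

section Expectation

/-- An injective `*`-homomorphism of C⋆-algebras reflects positivity. -/
theorem exists_eq_star_mul_self_of_map {A : Type u} {B : Type w} [CStarAlgebra A] [CStarAlgebra B]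
    (φ : A →⋆ₐ[ℂ] B) (hφ : Function.Injective φ) {a : A} {y : B} (h : φ a = star y * y) :
    ∃ b, a = star b * b := by
  let _ := CStarAlgebra.spectralOrder A
  have _ := CStarAlgebra.spectralOrderedRing A
  let _ := CStarAlgebra.spectralOrder B
  have _ := CStarAlgebra.spectralOrderedRing B
  have hpos : ∀ {c : A}, 0 ≤ c → 0 ≤ φ c := by
    intro c hc
    obtain ⟨d, rfl⟩ := CStarAlgebra.nonneg_iff_eq_star_mul_self.1 hc
    rw [map_mul, map_star]
    exact star_mul_self_nonneg _
  have hsa : IsSelfAdjoint a := hφ (by rw [map_star, h, star_mul, star_star])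
  have hya : 0 ≤ φ a := h ▸ star_mul_self_nonneg y
  -- By uniqueness of the decomposition into orthogonal positive parts, `φ` carries the negative
  -- part of `a` to that of `φ a`, which is zero.
  have hneg : φ a⁻ = (φ a)⁻ := by
    refine (CFC.posPart_negPart_unique (a := φ a) (b := φ a⁺) (c := φ a⁻) ?_ ?_ ?_ ?_).2.symm
    · rw [← map_sub, CFC.posPart_sub_negPart a hsa]
    · rw [← map_mul, CFC.posPart_mul_negPart, map_zero]
    · exact hpos (CFC.posPart_nonneg a)
    · exact hpos (CFC.negPart_nonneg a)
  rw [(CFC.negPart_eq_zero_iff (φ a) (IsSelfAdjoint.of_nonneg hya)).2 hya] at hneg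
  have h0 : a⁻ = 0 := hφ (by rw [hneg, map_zero])
  exact CStarAlgebra.nonneg_iff_eq_star_mul_self.1 ((CFC.negPart_eq_zero_iff a hsa).1 h0)

variable {A : Type u} [CStarAlgebra A]
variable {Γ : Type v} [AddCommGroup Γ] [LinearOrder Γ] [IsOrderedAddMonoid Γ]
variable {V H : PositiveAction A Γ}

/-- The integrand is pointwise of the form `d⋆ d`, and integration preserves positivity for the
spectral order. -/
theorem average_star_mul_self (c : CrossedProduct V H) :
    ∃ d, average V H (star c * c) = star d * d := by
  let _ := CStarAlgebra.spectralOrder (CrossedProduct V H)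
  have _ := CStarAlgebra.spectralOrderedRing (CrossedProduct V H)
  refine CStarAlgebra.nonneg_iff_eq_star_mul_self.1 ?_
  rw [average_apply]
  refine MeasureTheory.integral_nonneg fun χ => ?_
  rw [map_mul, map_star]
  exact star_mul_self_nonneg (dualAction V H c χ)

theorem average_quasiMonomials {F : Finset (PosCone Γ)} {qneg qpos : PosCone Γ → CrossedProduct V H}
    (a₀ : A) (h0 : 0 ∉ F) (hneg : ∀ x ∈ F, IsNegQuasiMonomial V H x (qneg x))
    (hpos : ∀ x ∈ F, IsPosQuasiMonomial V H x (qpos x)) :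
    average V H (∑ x ∈ F, qneg x + incl V H a₀ + ∑ x ∈ F, qpos x) = incl V H a₀ := by
  have hne : ∀ x ∈ F, (x : Γ) ≠ 0 := fun x hx h => h0 ((Subtype.ext h : x = 0) ▸ hx)
  rw [map_add, map_add, map_sum, map_sum, average_of_mem_zero (incl_mem_spectralSubspace a₀),
    Finset.sum_eq_zero fun x hx =>
      average_of_mem (neg_ne_zero.2 (hne x hx))
        (IsNegQuasiMonomial.mem_spectralSubspace (hneg x hx)),
    Finset.sum_eq_zero fun x hx =>
      average_of_mem (hne x hx) (IsPosQuasiMonomial.mem_spectralSubspace (hpos x hx)),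
    zero_add, add_zero]

/-- The average of the dual action, as a map to `A`. -/
theorem exists_expectation (hi : Function.Injective (incl V H)) :
    ∃ E : CrossedProduct V H →L[ℂ] A, ∀ c, incl V H (E c) = average V H c := by
  -- Preimages under the injective `incl` are unique, so the chosen function inherits linearity from
  -- `average`.
  choose e he using average_mem_range hi
  refine ⟨LinearMap.mkContinuous
    { toFun := e
      map_add' := fun b c => hi (by rw [map_add, he, he, he, map_add])
      map_smul' := fun r c => hi (by rw [RingHom.id_apply, map_smul, he, he, map_smul]) } 1
    fun c => ?_, he⟩
  rw [one_mul, ← NonUnitalStarAlgHom.norm_map (incl V H) hi]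
  change ‖incl V H (e c)‖ ≤ _
  rw [he]
  exact norm_average_le c

theorem extractsDegreeZero_of_incl (hi : Function.Injective (incl V H))
    {E : CrossedProduct V H →L[ℂ] A} (hE : ∀ c, incl V H (E c) = average V H c) :
    ExtractsDegreeZero E := fun _ _ _ a₀ h0 hneg hpos =>
  hi ((hE _).trans (average_quasiMonomials a₀ h0 hneg hpos))

theorem isConditionalExpectation_of_incl (hi : Function.Injective (incl V H))
    {E : CrossedProduct V H →L[ℂ] A} (hE : ∀ c, incl V H (E c) = average V H c) :
    IsConditionalExpectation E where
  apply_incl a := hi ((hE _).trans (average_of_mem_zero (incl_mem_spectralSubspace a)))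
  bimodule a b c := hi (by rw [hE, average_mul_incl, map_mul, map_mul, hE])
  positive c := by
    obtain ⟨d, hd⟩ := average_star_mul_self c
    exact exists_eq_star_mul_self_of_map (incl V H) hi ((hE _).trans hd)
  norm_le c := by
    rw [← NonUnitalStarAlgHom.norm_map (incl V H) hi, hE]
    exact norm_average_le c

end Expectation

/-! ### The norm formula -/

section BoundedSums

variable {Γ : Type v} [AddCommGroup Γ]

/-- The sums of multiples `n s` with `s ∈ S` and `n ≤ k`. -/
def boundedSums [DecidableEq Γ] (S : Finset Γ) (k : ℕ) : Finset Γ :=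
  (Fintype.piFinset fun _ : S => Finset.range (k + 1)).image fun f => ∑ s : S, f s • (s : Γ)

/-- The set is the image of a box with `k + 1` choices per element of `S`. For fixed `S` this is
polynomial in `k`, which is what the root in the norm formula requires. -/
theorem card_boundedSums_le [DecidableEq Γ] (S : Finset Γ) (k : ℕ) :
    (boundedSums S k).card ≤ (k + 1) ^ S.card := by
  refine Finset.card_image_le.trans ?_
  simp

theorem add_mem_boundedSums [DecidableEq Γ] {S : Finset Γ} {k : ℕ} {g s : Γ}
    (hg : g ∈ boundedSums S k) (hs : s ∈ S) : g + s ∈ boundedSums S (k + 1) := by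
  obtain ⟨f, hf, rfl⟩ := Finset.mem_image.1 hg
  rw [Fintype.mem_piFinset] at hf
  -- Adding `s` raises its own multiplicity by one.
  refine Finset.mem_image.2 ⟨f + Pi.single ⟨s, hs⟩ 1, Fintype.mem_piFinset.2 fun t => ?_, ?_⟩
  · have h := Finset.mem_range.1 (hf t)
    rw [Finset.mem_range, Pi.add_apply, Pi.single_apply]
    split_ifs <;> omega
  · simp [Pi.single_apply, add_smul, Finset.sum_add_distrib, ite_smul]

end BoundedSums

/-! ### Finitely supported elements and their norms -/

section Norm

variable {A : Type u} [CStarAlgebra A]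
variable {Γ : Type v} [AddCommGroup Γ] [LinearOrder Γ] [IsOrderedAddMonoid Γ]
variable {V H : PositiveAction A Γ}

variable (V H) in
/-- The elements whose degrees belong to `F`. -/
def supported (F : Finset Γ) : Submodule ℂ (CrossedProduct V H) :=
  ⨆ g ∈ F, spectralSubspace V H g

theorem mem_supported {F : Finset Γ} {g : Γ} (hg : g ∈ F) {c : CrossedProduct V H}
    (hc : c ∈ spectralSubspace V H g) : c ∈ supported V H F :=
  Submodule.mem_iSup_of_mem g (Submodule.mem_iSup_of_mem hg hc)

theorem exists_sum_of_mem_supported {F : Finset Γ} {c : CrossedProduct V H}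
    (hc : c ∈ supported V H F) :
    ∃ f : Γ → CrossedProduct V H, (∀ g, f g ∈ spectralSubspace V H g) ∧ c = ∑ g ∈ F, f g := by
  obtain ⟨μ, rfl⟩ := (Submodule.mem_iSup_finset_iff_exists_sum _ _).1 hc
  exact ⟨fun g => μ g, fun g => (μ g).2, rfl⟩

theorem exists_mem_supported {c : CrossedProduct V H} (hc : c ∈ core V H) :
    ∃ F : Finset Γ, c ∈ supported V H F := by
  classical
  refine core_induction (p := fun c => ∃ F : Finset Γ, c ∈ supported V H F) (fun a => ?_)
    (fun l _ => ?_) (fun l _ => ?_) ?_ hc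
  · exact ⟨{0}, mem_supported (Finset.mem_singleton_self _) (incl_mem_spectralSubspace a)⟩
  · exact ⟨_, mem_supported (Finset.mem_singleton_self _) (posMonomial_mem_spectralSubspace l)⟩
  · exact ⟨_, mem_supported (Finset.mem_singleton_self _) (negMonomial_mem_spectralSubspace l)⟩
  · rintro b c ⟨F, hF⟩ ⟨F', hF'⟩
    have hmono : ∀ {S T : Finset Γ}, S ⊆ T → supported V H S ≤ supported V H T :=
      fun h => biSup_mono fun g hg => h hg
    exact ⟨F ∪ F', add_mem (hmono Finset.subset_union_left hF)
      (hmono Finset.subset_union_right hF')⟩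

theorem pow_mem_supported [DecidableEq Γ] {S : Finset Γ} {c : CrossedProduct V H}
    (hc : c ∈ supported V H S) (k : ℕ) : c ^ k ∈ supported V H (boundedSums S k) := by
  induction k with
  | zero =>
    rw [pow_zero, ← map_one (incl V H)]
    refine mem_supported (g := 0) (Finset.mem_image.2 ⟨0, ?_, by simp⟩)
      (incl_mem_spectralSubspace 1)
    exact Fintype.mem_piFinset.2 fun _ => Finset.mem_range.2 (Nat.succ_pos 0)
  | succ k ih =>
    obtain ⟨f, hf, hfc⟩ := exists_sum_of_mem_supported ih
    obtain ⟨f', hf', hfc'⟩ := exists_sum_of_mem_supported hc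
    have hmul : c ^ (k + 1) = ∑ g ∈ boundedSums S k, ∑ s ∈ S, f g * f' s := by
      rw [pow_succ, hfc, ← Finset.sum_mul_sum, ← hfc']
    rw [hmul]
    exact sum_mem fun g hg => sum_mem fun s hs =>
      mem_supported (add_mem_boundedSums hg hs) (mul_mem_spectralSubspace (hf g) (hf' s))

/-- Averaging removes the cross terms of `c c⋆`, leaving a sum of positive elements that dominates
each summand. Every component thus has norm at most the square root of the norm of this sum, and the
triangle inequality costs one factor `F.card` before squaring. -/
theorem norm_mul_self_le_of_mem_supported {F : Finset Γ} {c : CrossedProduct V H}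
    (hc : c ∈ supported V H F) :
    ‖c‖ * ‖c‖ ≤ (F.card : ℝ) ^ 2 * ‖average V H (c * star c)‖ := by
  let _ := CStarAlgebra.spectralOrder (CrossedProduct V H)
  have _ := CStarAlgebra.spectralOrderedRing (CrossedProduct V H)
  obtain ⟨f, hf, rfl⟩ := exists_sum_of_mem_supported hc
  have hE : average V H ((∑ g ∈ F, f g) * star (∑ g ∈ F, f g)) = ∑ g ∈ F, f g * star (f g) := by
    rw [star_sum, Finset.sum_mul_sum, map_sum]
    refine Finset.sum_congr rfl fun g hg => ?_
    rw [map_sum, Finset.sum_eq_single_of_mem g hg]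
    · refine average_of_mem_zero ?_
      have h := mul_mem_spectralSubspace (hf g) (star_mem_spectralSubspace (hf g))
      rwa [add_neg_cancel] at h
    · intro h _ hne
      exact average_of_mem (fun h0 => hne (add_neg_eq_zero.1 h0).symm)
        (mul_mem_spectralSubspace (hf g) (star_mem_spectralSubspace (hf h)))
  rw [hE]
  set N := ‖∑ g ∈ F, f g * star (f g)‖ with hN
  have hle : ∀ g ∈ F, ‖f g‖ ≤ √N := by
    intro g hg
    refine Real.le_sqrt_of_sq_le ?_
    rw [sq, ← CStarRing.norm_self_mul_star]
    exact CStarAlgebra.norm_le_norm_of_nonneg_of_le (mul_star_self_nonneg _)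
      (Finset.single_le_sum (f := fun g => f g * star (f g))
        (fun h _ => mul_star_self_nonneg (f h)) hg)
  have h1 : ‖∑ g ∈ F, f g‖ ≤ F.card * √N := by
    simpa using norm_sum_le_of_le F hle
  calc _ ≤ (F.card * √N) * (F.card * √N) :=
        mul_self_le_mul_self (norm_nonneg _) h1
    _ = (F.card : ℝ) ^ 2 * (√N * √N) := by ring
    _ = _ := by rw [Real.mul_self_sqrt (norm_nonneg _)]

/-- A sequence that agrees with `r ^ (4 k)` up to a polynomial factor has `4 k`-th roots tending
to `r`. -/
theorem tendsto_rpow_of_polynomial_bound {r : ℝ} (hr : 0 ≤ r) (m : ℕ) {y : ℕ → ℝ}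
    (hy : ∀ k, 0 ≤ y k) (hle : ∀ k, k ≠ 0 → y k ≤ r ^ (4 * k))
    (hge : ∀ k : ℕ, k ≠ 0 → r ^ (4 * k) ≤ ((k : ℝ) + 1) ^ m * y k) :
    Filter.Tendsto (fun k : ℕ => y k ^ (1 / (4 * (k : ℝ)))) Filter.atTop (nhds r) := by
  have hlim : Filter.Tendsto (fun k : ℕ => ((k : ℝ) + 1) ^ ((m : ℝ) / (4 * (k : ℝ))))
      Filter.atTop (nhds 1) := by
    have h := (tendsto_rpow_div_mul_add (m : ℝ) 4 (-4) (by norm_num)).comp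
      (Filter.tendsto_atTop_add_const_right Filter.atTop (1 : ℝ) tendsto_natCast_atTop_atTop)
    refine h.congr fun k => ?_
    simp only [Function.comp_apply]
    congr 2
    ring
  have hroot : ∀ k : ℕ, 0 < k → (r ^ (4 * k)) ^ (1 / (4 * (k : ℝ))) = r := by
    intro k hk
    have h := Real.pow_rpow_inv_natCast hr (n := 4 * k) (by omega)
    rwa [Nat.cast_mul, Nat.cast_ofNat, ← one_div] at h
  have hlow : Filter.Tendsto (fun k : ℕ => r * (((k : ℝ) + 1) ^ ((m : ℝ) / (4 * (k : ℝ))))⁻¹)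
      Filter.atTop (nhds r) := by
    simpa using (hlim.inv₀ one_ne_zero).const_mul r
  refine tendsto_of_tendsto_of_tendsto_of_le_of_le' hlow tendsto_const_nhds ?_ ?_
  · filter_upwards [Filter.eventually_gt_atTop 0] with k hk
    have hk1 : (0 : ℝ) < (k : ℝ) + 1 := by positivity
    rw [← div_eq_mul_inv, div_le_iff₀ (Real.rpow_pos_of_pos hk1 _), mul_comm]
    calc r = (r ^ (4 * k)) ^ (1 / (4 * (k : ℝ))) := (hroot k hk).symm
      _ ≤ (((k : ℝ) + 1) ^ m * y k) ^ (1 / (4 * (k : ℝ))) :=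
        Real.rpow_le_rpow (by positivity) (hge k hk.ne') (by positivity)
      _ = _ := by
        rw [Real.mul_rpow (by positivity) (hy k), ← Real.rpow_natCast, ← Real.rpow_mul hk1.le,
          mul_one_div]
  · filter_upwards [Filter.eventually_gt_atTop 0] with k hk
    calc _ ≤ (r ^ (4 * k)) ^ (1 / (4 * (k : ℝ))) :=
          Real.rpow_le_rpow (hy k) (hle k hk.ne') (by positivity)
      _ = r := hroot k hk

/-- The C⋆-identity gives equality for exponents `2 ^ n`; a strict inequality at `n` would propagate
to `2 ^ n` by submultiplicativity. The exponent zero is excluded because `‖1‖ = 0` in the zero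
algebra. -/
theorem norm_pow_of_isSelfAdjoint {B : Type w} [CStarAlgebra B] {b : B} (hb : IsSelfAdjoint b)
    {n : ℕ} (hn : n ≠ 0) : ‖b ^ n‖ = ‖b‖ ^ n := by
  refine le_antisymm (norm_pow_le' b (Nat.pos_of_ne_zero hn)) ?_
  rcases (norm_nonneg b).eq_or_lt with h0 | h0
  · rw [← h0, zero_pow hn]; exact norm_nonneg _
  obtain ⟨d, hd⟩ : ∃ d, 2 ^ n = n + (d + 1) :=
    ⟨2 ^ n - n - 1, by have := n.lt_two_pow_self; omega⟩
  refine le_of_mul_le_mul_right ?_ (pow_pos h0 (d + 1))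
  calc ‖b‖ ^ n * ‖b‖ ^ (d + 1) = ‖b ^ 2 ^ n‖ := by rw [hb.norm_pow_two_pow, hd, pow_add _ n]
    _ ≤ ‖b ^ n‖ * ‖b ^ (d + 1)‖ := by rw [hd, pow_add _ n]; exact norm_mul_le _ _
    _ ≤ ‖b ^ n‖ * ‖b‖ ^ (d + 1) :=
      mul_le_mul_of_nonneg_left (norm_pow_le' b d.succ_pos) (norm_nonneg _)

theorem tendsto_norm_average {a : CrossedProduct V H} (ha : a ∈ core V H) :
    Filter.Tendsto (fun k : ℕ => ‖average V H ((a * star a) ^ (2 * k))‖ ^ (1 / (4 * (k : ℝ))))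
      Filter.atTop (nhds ‖a‖) := by
  classical
  obtain ⟨S, hS⟩ := exists_mem_supported (mul_mem ha (star_mem ha))
  have hsa : IsSelfAdjoint (a * star a) := IsSelfAdjoint.mul_star_self a
  have hnorm : ∀ k, k ≠ 0 → ‖(a * star a) ^ k‖ = ‖a‖ ^ (2 * k) := fun k hk => by
    rw [norm_pow_of_isSelfAdjoint hsa hk, CStarRing.norm_self_mul_star, ← sq, pow_mul]
  -- The exponent is doubled because the number of degrees enters the norm estimate squared.
  refine tendsto_rpow_of_polynomial_bound (norm_nonneg a) (S.card * 2)
    (fun k => norm_nonneg _) (fun k hk => ?_) fun k hk => ?_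
  · refine (norm_average_le _).trans_eq ?_
    rw [hnorm _ (by omega)]
    congr 1
    omega
  -- For the self-adjoint `c = (a a⋆)^k`, `c c⋆` is `(a a⋆)^(2k)` and `‖c‖²` is `‖a‖^(4k)`.
  · have h := norm_mul_self_le_of_mem_supported (pow_mem_supported hS k)
    rw [(hsa.pow k).star_eq, ← pow_add, ← two_mul, hnorm k hk, ← pow_add, ← two_mul,
      ← mul_assoc] at h
    refine h.trans (mul_le_mul_of_nonneg_right ?_ (norm_nonneg _))
    rw [pow_mul]
    gcongr
    exact_mod_cast card_boundedSums_le S k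

end Norm

end Interaction

end

theorem theorem5p2 {A : Type u} [CStarAlgebra A]
    {Γ : Type v} [AddCommGroup Γ] [LinearOrder Γ] [IsOrderedAddMonoid Γ]
    (V H : Interaction.PositiveAction A Γ)
    (hV : Interaction.FinelyRepresentable.{u, v, w} V)
    (hVH : Interaction.IsCompleteInteraction V H) :
    (∃! E₀ : Interaction.CrossedProduct V H →L[ℂ] A,
      Interaction.CrossedProduct.ExtractsDegreeZero E₀) ∧
    ∀ E₀ : Interaction.CrossedProduct V H →L[ℂ] A,
      Interaction.CrossedProduct.ExtractsDegreeZero E₀ →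
        Interaction.CrossedProduct.IsConditionalExpectation E₀ ∧
        ∀ a ∈ Interaction.CrossedProduct.core V H,
          Filter.Tendsto
            (fun k : ℕ => ‖E₀ ((a * star a) ^ (2 * k))‖ ^ (1 / (4 * (k : ℝ))))
            Filter.atTop (nhds ‖a‖) := by
  have hi := Interaction.CrossedProduct.incl_injective hV hVH
  obtain ⟨E, hE⟩ := Interaction.exists_expectation hi
  have hE0 := Interaction.extractsDegreeZero_of_incl hi hE
  refine ⟨⟨E, hE0, fun E' hE' => hE'.eq hE0⟩, fun E₀ hE₀ => ?_⟩
  -- Uniqueness transfers every property of the averaged expectation to `E₀`.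
  obtain rfl := hE₀.eq hE0
  refine ⟨Interaction.isConditionalExpectation_of_incl hi hE, fun a ha => ?_⟩
  refine (Interaction.tendsto_norm_average ha).congr fun k => ?_
  rw [← hE, NonUnitalStarAlgHom.norm_map _ hi]
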